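/- Let $d,m\ge 2$ be integers and $\alpha\in(0,2]$. For $n\ge1$ let $Q(\mathbb R^n)$ be the set of invertible linear operators on $\mathbb R^n$ all of whose (complex) eigenvalues have positive real part; $|\cdot|$ is the Euclidean norm, $\|\cdot\|$ the operator norm, $I$ the identity, and $r^A=\exp((\ln r)A)$ for $r>0$. Let $E\in Q(\mathbb R^d)$, let $q$ be the trace of $E$, and let $\tau$ be the radial part of the polar coordinates under $E$: $\tau(0)=0$, and for $x\ne0$, $\tau(x)$ is the unique $r>0$ with $\|r^{-E}x\|_0=1$, where $\|x\|_0=\int_0^1|t^Ex|\,\frac{dt}{t}$. A function $\phi:\mathbb R^d\to[0,\infty)$ is $E$-homogeneous if $\phi(r^Ex)=r\phi(x)$ for all $r>0$, $x\neq 0$. It is $(\beta,E)$-admissible ($\beta>0$) if $\phi(x)>0$ for $x\ne0$ and for all $0<A<B$ there is $C>0$ such that $|\phi(x+y)-\phi(y)|\le C\,\tau(x)^\beta$ whenever $A\le|y|\le B$ and $\tau(x)\le 1$. Let $\Gamma$ be the uniform measure on the unit sphere $S_{m-1}$ of $\mathbb R^m$, normalized so that $\int|\langle s,\theta\rangle|^\alpha\,\Gamma(ds)=|\theta|^\alpha$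 for all $\theta\in\mathbb R^m$. Let $M$ be an $\mathbb R^m$-valued symmetric $\alpha$-stable (S$\alpha$S) random measure on $\mathbb R^d$ with control measure $K=\lambda_d\times\Gamma$ ($\lambda_d$ is Lebesgue measure), i.e. an independently scattered, (almost surely) $\sigma$-additive family of random vectors $M(A)$, indexed by the Borel sets $A$ with $\lambda_d(A)<\infty$, on a probability space, such that $\mathbb E\,e^{i\langle\theta,M(A)\rangle}=\exp\bigl(-\int_{S_{m-1}}|\langle s,\theta\rangle|^\alpha K(A,ds)\bigr)$ for all $\theta\in\mathbb R^m$. For a Borel measurable matrix-valued function $F$ with $\int_{\mathbb R^d}\|F(u)\|^\alpha du<\infty$, the stochastic integral $\int F(u)\,M(du)$ is the limit in probability of $\int F_n\,dM$ along sequences of simple functions $F_n$ (vanishing off sets of finite Lebesgue measure) with $\int\|F_n-F\|^\alpha du\to0$, where $\int\sum_jR_j\mathbf 1_{A_j}\,dM=\sum_jR_jM(A_j)$ for disjoint $A_j$. **Theorem.** Let $\phi:\mathbb R^d\to[0,\infty)$ be $E$-homogeneous and $(\beta,E)$-admissible for some $\beta>0$, let $D\in Q(\mathbb R^m)$, and let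 $H$ be the maximum of the real parts of the eigenvalues of $D$. If $H<\beta$, then the random field $$X_\phi(x)=\int_{\mathbb R^d}\Bigl[\phi(x-y)^{D-qI/\alpha}-\phi(-y)^{D-qI/\alpha}\Bigr]M(dy),\qquad x\in\mathbb R^d,$$ is well defined: for each $x$ the integrand is Borel measurable, the $\alpha$-th power of its operator norm is Lebesgue integrable, and the stochastic integral exists and is almost surely unique. Moreover: 1. $X_\phi$ is stochastically continuous (continuous in probability at every point of $\mathbb R^d$); 2. $X_\phi$ is $(E,D)$-operator-self-similar: for every $r>0$, the fields $\{X_\phi(r^Ex)\}_{x\in\mathbb R^d}$ and $\{r^DX_\phi(x)\}_{x\in\mathbb R^d}$ have the same finite-dimensional distributions; 3. $X_\phi$ is an S$\alpha$S random field: all its finite-dimensional distributions are jointly symmetric $\alpha$-stable; 4. $X_\phi$ has stationary increments: for every $h\in\mathbb R^d$, the fields $\{X_\phi(x+h)-X_\phi(h)\}_{x\in\mathbb R^d}$ and $\{X_\phi(x)\}_{x\in\mathbb R^d}$ have the same finite-dimensional distributions. (The at most two points $y$, for each $x$, at which $\phi$ is evaluated at $0$ form a null set; there the value of the integrand is immaterial.)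 -/

import Mathlib

open MeasureTheory ProbabilityTheory Filter Topology
open scoped ENNReal

noncomputable section

namespace OSS

/-- `ℝⁿ` with its Euclidean norm. -/
abbrev Rn (n : ℕ) : Type := EuclideanSpace ℝ (Fin n)

/-- The linear operators on `ℝⁿ`, with the operator norm for the Euclidean norm. -/
abbrev Op (n : ℕ) : Type := Rn n →L[ℝ] Rn n

/-- The unit sphere of `ℝᵐ`. -/
abbrev Sph (m : ℕ) : Type := Metric.sphere (0 : Rn m) 1

/-! ### Linear operators -/

/-- `r ^ A = exp (log r • A)`, for `r > 0`. -/
def opPow {n : ℕ} (r : ℝ) (A : Op n) : Op n := NormedSpace.exp (Real.log r • A)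

/-- `z` is a complex eigenvalue of the real operator `A`. -/
def IsEigenvalue {n : ℕ} (A : Op n) (z : ℂ) : Prop :=
  Module.End.HasEigenvalue ((A : Rn n →ₗ[ℝ] Rn n).baseChange ℂ) z

/-- `Q(ℝⁿ)`: the invertible operators all of whose eigenvalues have positive real part. -/
def Q (n : ℕ) : Set (Op n) :=
  {A | IsUnit A ∧ ∀ z : ℂ, IsEigenvalue A z → 0 < z.re}

/-- The real parts of the eigenvalues of `A`. -/
def reEigenvalues {n : ℕ} (A : Op n) : Set ℝ :=
  {h | ∃ z : ℂ, IsEigenvalue A z ∧ z.re = h}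

/-- The trace of `A`. -/
def tr {n : ℕ} (A : Op n) : ℝ := LinearMap.trace ℝ (Rn n) (A : Rn n →ₗ[ℝ] Rn n)

/-! ### Polar coordinates, homogeneous and admissible functions -/

/-- The norm `‖x‖₀ = ∫₀¹ |t^E x| dt / t`; for `E ∈ Q(ℝⁿ)` and `x ≠ 0` the function
`r ↦ ‖r^E x‖₀` is a strictly increasing bijection of `(0, ∞)`. -/
def polarNorm {n : ℕ} (E : Op n) (x : Rn n) : ℝ :=
  ∫ t in (0 : ℝ)..1, ‖opPow t E x‖ / t

/-- The radial part `τ(x)` of the polar coordinates `x = τ(x)^E l(x)`, `‖l(x)‖₀ = 1`: for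
`x ≠ 0` it is the only `r > 0` with `‖r^{-E} x‖₀ = 1`, written as the infimum of the `r > 0`
with `‖r^{-E} x‖₀ ≤ 1`; and `τ(0) = 0`. -/
def radialPart {n : ℕ} (E : Op n) (x : Rn n) : ℝ :=
  sInf {r : ℝ | 0 < r ∧ polarNorm E (opPow r (-E) x) ≤ 1}

/-- `φ` is `E`-homogeneous. -/
def IsHomogeneous {n : ℕ} (E : Op n) (φ : Rn n → ℝ) : Prop :=
  ∀ r : ℝ, 0 < r → ∀ x : Rn n, x ≠ 0 → φ (opPow r E x) = r * φ x

/-- `ψ : ℝⁿ → [0, ∞)` is `(β, E)`-admissible. -/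
def IsAdmissible {n : ℕ} (β : ℝ) (E : Op n) (ψ : Rn n → ℝ) : Prop :=
  (∀ x, 0 ≤ ψ x) ∧ (∀ x, x ≠ 0 → 0 < ψ x) ∧
    ∀ A B : ℝ, 0 < A → A < B → ∃ C : ℝ, 0 < C ∧
      ∀ x y : Rn n, A ≤ ‖y‖ → ‖y‖ ≤ B → radialPart E x ≤ 1 →
        |ψ (x + y) - ψ y| ≤ C * radialPart E x ^ β

/-! ### Stable random measures -/

/-- The uniform measure `Γ` on the unit sphere of `ℝᵐ`: the surface measure multiplied by the
constant for which `∑ₗ ∫ |sₗ|^α Γ(ds) = m`. By `integral_unifSphere` below this is the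
normalization `∫ |⟨s, θ⟩|^α Γ(ds) = |θ|^α` for all `θ`. -/
def unifSphere (α : ℝ) (m : ℕ) : Measure (Sph m) :=
  ENNReal.ofReal (m / ∑ l : Fin m, ∫ s : Sph m, |(s : Rn m) l| ^ α
      ∂((volume : Measure (Rn m)).toSphere)) •
    (volume : Measure (Rn m)).toSphere

/-- The control measure `K = λ_d × Γ`. -/
def control (α : ℝ) (d m : ℕ) : Measure (Rn d × Sph m) :=
  (volume : Measure (Rn d)).prod (unifSphere α m)

/-- The Borel sets `A` with `K(A × S) < ∞`. -/
def finiteSets {d m : ℕ} (K : Measure (Rn d × Sph m)) : Set (Set (Rn d)) :=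
  {A | MeasurableSet A ∧ K (A ×ˢ Set.univ) < ∞}

/-- The finite measure `K(A, ·)` on the sphere. -/
def slice {d m : ℕ} (K : Measure (Rn d × Sph m)) (A : Set (Rn d)) : Measure (Sph m) :=
  (K.restrict (A ×ˢ Set.univ)).snd

/-- `M` is an `ℝᵐ`-valued symmetric `α`-stable random measure on `ℝᵈ` with control measure `K`.
Only the values of `M` on `finiteSets K` matter. -/
structure IsSaSRandomMeasure {Ω : Type*} [MeasurableSpace Ω] (P : Measure Ω) (α : ℝ) {d m : ℕ}
    (K : Measure (Rn d × Sph m)) (M : Set (Rn d) → Ω → Rn m) : Prop where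
  measurable : ∀ A ∈ finiteSets K, Measurable (M A)
  indep_scattered : ∀ (k : ℕ) (A : Fin k → Set (Rn d)), (∀ i, A i ∈ finiteSets K) →
    Pairwise (fun i j => Disjoint (A i) (A j)) → iIndepFun (fun i => M (A i)) P
  sigma_additive : ∀ A : ℕ → Set (Rn d), (∀ n, A n ∈ finiteSets K) →
    Pairwise (fun i j => Disjoint (A i) (A j)) → (⋃ n, A n) ∈ finiteSets K →
    ∀ᵐ ω ∂P, Tendsto (fun n => ∑ i ∈ Finset.range n, M (A i) ω) atTop (𝓝 (M (⋃ n, A n) ω))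
  /-- `M A` is jointly symmetric `α`-stable with spectral measure `K(A, ·)`. -/
  spectral : ∀ A ∈ finiteSets K, ∀ θ : Rn m, charFun (P.map (M A)) θ =
    Complex.exp (-((∫ s : Sph m, |inner ℝ (s : Rn m) θ| ^ α ∂(slice K A) : ℝ) : ℂ))

/-! ### Stochastic integrals -/

/-- The integral `∑ⱼ Rⱼ M(Aⱼ)` of the simple function `∑ⱼ Rⱼ 1_{Aⱼ}`, where the `Rⱼ` are its
values and the `Aⱼ` its level sets (the value `0` contributes `0`). -/
def simpleIntegral {Ω : Type*} {d m : ℕ} (M : Set (Rn d) → Ω → Rn m)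
    (F : SimpleFunc (Rn d) (Op m)) (ω : Ω) : Rn m :=
  ∑ R ∈ F.range, R (M (F ⁻¹' {R}) ω)

/-- `∫ ‖F(u)‖^α du`. -/
def intNormPow {d m : ℕ} (α : ℝ) (F : Rn d → Op m) : ℝ≥0∞ := ∫⁻ u, ‖F u‖ₑ ^ α

/-- The simple functions `F n` (vanishing off sets of finite Lebesgue measure) approximate `F`:
`∫ ‖F n (u) - F(u)‖^α du → 0`. -/
def Approximates {d m : ℕ} (α : ℝ) (Fn : ℕ → SimpleFunc (Rn d) (Op m)) (F : Rn d → Op m) :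
    Prop :=
  (∀ n, (Fn n).FinMeasSupp volume) ∧
    Tendsto (fun n => intNormPow α (fun u => Fn n u - F u)) atTop (𝓝 0)

/-- `F` is Borel measurable with `∫ ‖F(u)‖^α du < ∞`, and the random vector `Y` is (a version
of) the stochastic integral `∫ F(u) M(du)`: approximating sequences of simple functions exist,
and for each of them the integrals converge to `Y` in probability. -/
structure IsStochasticIntegral {Ω : Type*} [MeasurableSpace Ω] (P : Measure Ω) (α : ℝ)
    {d m : ℕ} (M : Set (Rn d) → Ω → Rn m) (F : Rn d → Op m) (Y : Ω → Rn m) : Prop where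
  measurable_integrand : Measurable F
  integrable : intNormPow α F < ∞
  measurable : Measurable Y
  exists_approx : ∃ Fn : ℕ → SimpleFunc (Rn d) (Op m), Approximates α Fn F
  tendsto : ∀ Fn : ℕ → SimpleFunc (Rn d) (Op m), Approximates α Fn F →
    TendstoInMeasure P (fun n => simpleIntegral M (Fn n)) atTop Y

open Classical in
/-- The stochastic integral `∫ F(u) M(du)` (`0` if it is not defined). -/
def stochasticIntegral {Ω : Type*} [MeasurableSpace Ω] (P : Measure Ω) (α : ℝ)
    {d m : ℕ} (M : Set (Rn d) → Ω → Rn m) (F : Rn d → Op m) : Ω → Rn m :=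
  if h : ∃ Y, IsStochasticIntegral P α M F Y then h.choose else 0

/-- The matrix-valued function `y ↦ φ(x - y)^{D - qI/α} - φ(-y)^{D - qI/α}`, `q` the trace
of `E`. (For `x` fixed, the at most two `y` at which `φ` is evaluated at `0` are a null set.) -/
def maKernel {d m : ℕ} (α : ℝ) (E : Op d) (D : Op m) (φ : Rn d → ℝ) (x y : Rn d) : Op m :=
  opPow (φ (x - y)) (D - (tr E / α) • ContinuousLinearMap.id ℝ (Rn m)) -
    opPow (φ (-y)) (D - (tr E / α) • ContinuousLinearMap.id ℝ (Rn m))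

/-- The moving-average field `X_φ(x) = ∫ [φ(x - y)^{D - qI/α} - φ(-y)^{D - qI/α}] M(dy)`. -/
def movingAverage {Ω : Type*} [MeasurableSpace Ω] (P : Measure Ω) (α : ℝ) {d m : ℕ}
    (M : Set (Rn d) → Ω → Rn m) (E : Op d) (D : Op m) (φ : Rn d → ℝ) (x : Rn d) : Ω → Rn m :=
  stochasticIntegral P α M (maKernel α E D φ x)

/-! ### Random fields -/

/-- The random fields `X` and `Y` have the same finite-dimensional distributions. -/
def SameFDD {Ω : Type*} [MeasurableSpace Ω] (P : Measure Ω) {d m : ℕ}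
    (X Y : Rn d → Ω → Rn m) : Prop :=
  ∀ T : Finset (Rn d), IdentDistrib (fun ω (t : T) => X t ω) (fun ω (t : T) => Y t ω) P P

/-- `X` is continuous in probability at each point. -/
def StochasticallyContinuous {Ω : Type*} [MeasurableSpace Ω] (P : Measure Ω) {d m : ℕ}
    (X : Rn d → Ω → Rn m) : Prop :=
  ∀ x₀ : Rn d, TendstoInMeasure P X (𝓝 x₀) (X x₀)

/-- `X` is operator-self-similar with exponents `(E, D)`. -/
def IsOSS {Ω : Type*} [MeasurableSpace Ω] (P : Measure Ω) {d m : ℕ} (E : Op d) (D : Op m)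
    (X : Rn d → Ω → Rn m) : Prop :=
  ∀ r : ℝ, 0 < r → SameFDD P (fun t => X (opPow r E t)) (fun t ω => opPow r D (X t ω))

/-- `X` has stationary increments. -/
def HasStationaryIncrements {Ω : Type*} [MeasurableSpace Ω] (P : Measure Ω) {d m : ℕ}
    (X : Rn d → Ω → Rn m) : Prop :=
  ∀ h : Rn d, SameFDD P (fun t ω => X (t + h) ω - X h ω) X

/-- `μ` is a symmetric `α`-stable law: it is symmetric, and if `Z₁`, `Z₂` are independent with
law `μ` and `a, b > 0`, then `a Z₁ + b Z₂` has the law of `(a^α + b^α)^{1/α} Z₁`. -/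
def IsSaSLaw {F : Type*} [AddCommGroup F] [Module ℝ F] [MeasurableSpace F] (α : ℝ)
    (μ : Measure F) : Prop :=
  IsProbabilityMeasure μ ∧ μ.map (fun z => -z) = μ ∧
    ∀ a b : ℝ, 0 < a → 0 < b →
      (μ.prod μ).map (fun z => a • z.1 + b • z.2) = μ.map (fun z => (a ^ α + b ^ α) ^ α⁻¹ • z)

/-- `X` is a symmetric `α`-stable random field: all its finite-dimensional distributions are
(jointly) symmetric `α`-stable. -/
def IsSaSField {Ω : Type*} [MeasurableSpace Ω] (P : Measure Ω) (α : ℝ) {d m : ℕ}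
    (X : Rn d → Ω → Rn m) : Prop :=
  (∀ x, AEMeasurable (X x) P) ∧
    ∀ T : Finset (Rn d), IsSaSLaw α (P.map (fun ω (t : T) => X t ω))

/-! ### The normalization of the uniform measure -/

open scoped Pointwise in
theorem toSphere_map_isometry {m : ℕ} (U : Rn m ≃ₗᵢ[ℝ] Rn m) (V : Sph m → Sph m)
    (hV : ∀ s, (V s : Rn m) = U s) :
    (volume : Measure (Rn m)).toSphere.map V = (volume : Measure (Rn m)).toSphere := by
  have hVm : Measurable V := by
    have hc : Measurable fun s : Sph m => U (s : Rn m) :=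
      (U.continuous.comp continuous_subtype_val).measurable
    have hVe : V = fun s => ⟨U (s : Rn m), by simp⟩ := funext fun s => Subtype.ext (hV s)
    rw [hVe]
    exact hc.subtype_mk
  ext A hA
  rw [Measure.map_apply hVm hA, Measure.toSphere_apply' _ (hVm hA), Measure.toSphere_apply' _ hA]
  congr 1
  have h : U ⁻¹' (Set.Ioo (0 : ℝ) 1 • (((↑) : Sph m → Rn m) '' A)) =
      Set.Ioo (0 : ℝ) 1 • (((↑) : Sph m → Rn m) '' (V ⁻¹' A)) := by
    ext x
    simp only [Set.mem_preimage, Set.mem_smul, Set.mem_image]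
    constructor
    · rintro ⟨r, hr, _, ⟨s, hs, rfl⟩, h⟩
      have hn : ‖U.symm (s : Rn m)‖ = 1 := by simp
      refine ⟨r, hr, U.symm s, ⟨⟨U.symm s, by simp⟩, ?_, rfl⟩, ?_⟩
      · have : V ⟨U.symm s, by simp⟩ = s := by
          apply Subtype.ext
          rw [hV]; simp
        rw [this]; exact hs
      · apply U.injective
        rw [map_smul, ← h]; simp
    · rintro ⟨r, hr, _, ⟨s, hs, rfl⟩, rfl⟩
      exact ⟨r, hr, V s, ⟨V s, hs, rfl⟩, by rw [hV, map_smul]⟩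
  rw [← h]
  exact U.measurePreserving.measure_preimage_equiv (f := U.toMeasurableEquiv) _

theorem integral_sphere_eq {m : ℕ} (α : ℝ) (u v : Rn m) (h : ‖u‖ = ‖v‖) :
    ∫ s : Sph m, |inner ℝ (s : Rn m) u| ^ α ∂((volume : Measure (Rn m)).toSphere) =
      ∫ s : Sph m, |inner ℝ (s : Rn m) v| ^ α ∂((volume : Measure (Rn m)).toSphere) := by
  set U : Rn m ≃ₗᵢ[ℝ] Rn m := (Submodule.span ℝ {u - v})ᗮ.reflection with hU
  have hUu : U u = v := Submodule.reflection_sub h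
  let V : Sph m → Sph m := fun s => ⟨U s, by simp⟩
  have hVc : Continuous V := by
    apply Continuous.subtype_mk
    exact U.continuous.comp continuous_subtype_val
  conv_rhs => rw [← toSphere_map_isometry U V (fun _ => rfl)]
  rw [integral_map hVc.aemeasurable]
  · refine integral_congr_ae (Eventually.of_forall fun s => ?_)
    simp only [V]
    rw [← hUu, U.inner_map_map]
  · apply Measurable.aestronglyMeasurable
    fun_prop

/-- The normalization `∫ |⟨s, θ⟩|^α Γ(ds) = |θ|^α`. -/
theorem integral_unifSphere {α : ℝ} (hα : 0 < α) {m : ℕ} (hm : 1 ≤ m) (θ : Rn m) :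
    ∫ s : Sph m, |inner ℝ (s : Rn m) θ| ^ α ∂(unifSphere α m) = ‖θ‖ ^ α := by
  set σ := (volume : Measure (Rn m)).toSphere with hσ
  have hm0 : (m : ℝ) ≠ 0 := by positivity
  obtain ⟨i⟩ : Nonempty (Fin m) := ⟨⟨0, hm⟩⟩
  let e : Fin m → Rn m := fun l => EuclideanSpace.single l 1
  have he : ∀ l, ‖e l‖ = 1 := fun l => by simp [e]
  set c := ∫ s : Sph m, |inner ℝ (s : Rn m) (e i)| ^ α ∂σ with hc
  have hsum : (∑ l : Fin m, ∫ s : Sph m, |(s : Rn m) l| ^ α ∂σ) = m * c := by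
    have : ∀ l : Fin m, ∫ s : Sph m, |(s : Rn m) l| ^ α ∂σ = c := fun l => by
      rw [hc, ← integral_sphere_eq α (e l) (e i) (by rw [he, he])]
      simp [e, EuclideanSpace.inner_single_right, hσ]
    simp [this]
  have hcpos : 0 < c := by
    have hcont : Continuous fun s : Sph m => |inner ℝ (s : Rn m) (e i)| ^ α :=
      ((by fun_prop : Continuous fun s : Sph m => |inner ℝ (s : Rn m) (e i)|)).rpow_const
        (fun _ => Or.inr hα.le)
    refine hcont.integral_pos_of_hasCompactSupport_nonneg_nonzero
      (HasCompactSupport.of_compactSpace _) (fun s => by positivity)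
      (x := ⟨e i, by simp [he]⟩) ?_
    simp [he]
  have key : ∫ s : Sph m, |inner ℝ (s : Rn m) θ| ^ α ∂σ = ‖θ‖ ^ α * c := by
    have h1 := integral_sphere_eq α θ (‖θ‖ • e i) (by simp [norm_smul, he])
    rw [h1, hc, ← integral_const_mul]
    refine integral_congr_ae (Eventually.of_forall fun s => ?_)
    simp only [inner_smul_right, abs_mul, abs_norm]
    rw [Real.mul_rpow (norm_nonneg _) (abs_nonneg _)]
  rw [unifSphere, integral_smul_measure, ← hσ, hsum, key, ENNReal.toReal_ofReal (by positivity),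
    smul_eq_mul]
  field_simp

end OSS

end

open MeasureTheory ProbabilityTheory Filter Topology
open scoped ENNReal
noncomputable section
namespace OSS

theorem exp_apply_of_hasEigenvector {V : Type*} [NormedAddCommGroup V] [NormedSpace ℂ V]
    [CompleteSpace V] (A : V →L[ℂ] V) {z : ℂ} {v : V} (hv : A v = z • v) :
    NormedSpace.exp A v = Complex.exp z • v := by
  have hp : ∀ k : ℕ, (A ^ k) v = z ^ k • v := by
    intro k
    induction k with
    | zero => simp
    | succ k ih => rw [pow_succ, mul_apply_eq_comp, hv, map_smul, ih, smul_smul, pow_succ']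
  have h1 := (NormedSpace.exp_series_hasSum_exp' (𝕂 := ℂ) A).mapL (ContinuousLinearMap.apply ℂ V v)
  have h2 := (NormedSpace.exp_series_hasSum_exp' (𝕂 := ℂ) z).smul_const v
  rw [← Complex.exp_eq_exp_ℂ] at h2
  refine h1.unique ?_
  convert h2 using 2 with k
  simp [hp, smul_smul]

/-- One half of the spectral mapping theorem for the exponential in finite dimension. -/
theorem exists_eigenvalue_of_mem_spectrum_exp {V : Type*} [NormedAddCommGroup V] [NormedSpace ℂ V]
    [FiniteDimensional ℂ V] (A : V →L[ℂ] V) {μ : ℂ}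
    (hμ : μ ∈ spectrum ℂ (NormedSpace.exp A)) :
    ∃ z : ℂ, Module.End.HasEigenvalue (A : V →ₗ[ℂ] V) z ∧ Complex.exp z = μ := by
  have : CompleteSpace V := FiniteDimensional.complete ℂ V
  set B : Module.End ℂ V := ((NormedSpace.exp A : V →L[ℂ] V) : V →ₗ[ℂ] V) with hB
  have hsp : μ ∈ spectrum ℂ B := by
    rw [spectrum.mem_iff] at hμ ⊢
    intro hu
    apply hμ
    have : (algebraMap ℂ (Module.End ℂ V) μ - B) =
      (LinearMap.toContinuousLinearMap.symm (algebraMap ℂ (V →L[ℂ] V) μ - NormedSpace.exp A)) := by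
      ext; simp [hB, Algebra.algebraMap_eq_smul_one]
    rw [this] at hu
    have hu' : IsUnit (algebraMap ℂ (V →L[ℂ] V) μ - NormedSpace.exp A) :=
      hu.map (Module.End.toContinuousLinearMap V)
    exact hu'
  have hev := Module.End.hasEigenvalue_iff_mem_spectrum.2 hsp
  have hcomm : ∀ x, B (A x) = A (B x) := by
    intro x
    have : Commute (NormedSpace.exp A) A := (Commute.refl A).exp_left
    exact DFunLike.congr_fun this.eq x
  set W := Module.End.eigenspace B μ with hW
  have hinv : ∀ x ∈ W, (A : V →ₗ[ℂ] V) x ∈ W := by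
    intro x hx
    rw [hW, Module.End.mem_eigenspace_iff] at hx ⊢
    simp only [ContinuousLinearMap.coe_coe]
    rw [hcomm, hx, map_smul]
  have : Nontrivial W := Submodule.nontrivial_iff_ne_bot.2 hev
  obtain ⟨z, hz⟩ := Module.End.exists_eigenvalue ((A : V →ₗ[ℂ] V).restrict hinv)
  obtain ⟨w, hw⟩ := hz.exists_hasEigenvector
  have hAw : A (w : V) = z • (w : V) := by
    have := congrArg Subtype.val hw.apply_eq_smul
    simpa using this
  have hw0 : (w : V) ≠ 0 := by simpa using hw.2
  refine ⟨z, Module.End.hasEigenvalue_of_hasEigenvector (x := (w : V))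
    ⟨Module.End.mem_eigenspace_iff.2 hAw, hw0⟩, ?_⟩
  have h1 := exp_apply_of_hasEigenvector A hAw
  have h2 : NormedSpace.exp A (w : V) = μ • (w : V) := Module.End.mem_eigenspace_iff.1 w.2
  rw [h2] at h1
  exact (smul_left_injective ℂ hw0 h1).symm

abbrev Cn (n : ℕ) : Type := EuclideanSpace ℂ (Fin n)

/-- The complexification of an operator on `ℝⁿ`, as an operator on `ℂⁿ`. -/
def complexify (n : ℕ) : Op n →ₐ[ℝ] (Cn n →L[ℂ] Cn n) :=
  (((Matrix.toEuclideanCLM (n := Fin n) (𝕜 := ℂ)).toAlgEquiv.toAlgHom).restrictScalars ℝ).comp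
    ((Complex.ofRealAm.mapMatrix).comp
      (Matrix.toEuclideanCLM (n := Fin n) (𝕜 := ℝ)).symm.toAlgEquiv.toAlgHom)

theorem complexify_injective (n : ℕ) : Function.Injective (complexify n) := by
  have h : Function.Injective (Complex.ofRealAm.mapMatrix (m := Fin n)) := by
    intro M N hMN
    ext i j
    have := congrFun (congrFun hMN i) j
    simpa using this
  exact (Matrix.toEuclideanCLM (n := Fin n) (𝕜 := ℂ)).injective.comp
    (h.comp (Matrix.toEuclideanCLM (n := Fin n) (𝕜 := ℝ)).symm.injective)

theorem complexify_continuous (n : ℕ) : Continuous (complexify n) :=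
  (complexify n).toLinearMap.continuous_of_finiteDimensional

theorem isEigenvalue_of_complexify {n : ℕ} {A : Op n} {z : ℂ}
    (h : Module.End.HasEigenvalue (complexify n A : Cn n →ₗ[ℂ] Cn n) z) : IsEigenvalue A z := by
  unfold IsEigenvalue
  set b := (EuclideanSpace.basisFun (Fin n) ℝ).toBasis
  set bc := (EuclideanSpace.basisFun (Fin n) ℂ).toBasis
  rw [Module.End.hasEigenvalue_iff_mem_spectrum] at h ⊢
  rw [← AlgEquiv.spectrum_eq (LinearMap.toMatrixAlgEquiv bc)] at h
  rw [← AlgEquiv.spectrum_eq (LinearMap.toMatrixAlgEquiv (b.baseChange ℂ))]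
  have h2 : LinearMap.toMatrixAlgEquiv (b.baseChange ℂ) ((A : Rn n →ₗ[ℝ] Rn n).baseChange ℂ) =
    (LinearMap.toMatrix b b (A : Rn n →ₗ[ℝ] Rn n)).map (algebraMap ℝ ℂ) :=
    by
    ext i j
    simp only [LinearMap.toMatrixAlgEquiv_apply, LinearMap.toMatrix_apply, Matrix.map_apply]
    simp [Module.Basis.baseChange_apply]
  have h3 : LinearMap.toMatrixAlgEquiv bc (complexify n A : Cn n →ₗ[ℂ] Cn n) =
    (LinearMap.toMatrix b b (A : Rn n →ₗ[ℝ] Rn n)).map (algebraMap ℝ ℂ) := by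
    have h4 : (complexify n A : Cn n →ₗ[ℂ] Cn n) = Matrix.toLin bc bc
      ((LinearMap.toMatrix b b (A : Rn n →ₗ[ℝ] Rn n)).map (algebraMap ℝ ℂ)) := rfl
    have h5 := LinearMap.toMatrix_toLin bc bc
      ((LinearMap.toMatrix b b (A : Rn n →ₗ[ℝ] Rn n)).map (algebraMap ℝ ℂ))
    rw [← h4] at h5
    exact h5
  rw [h2, ← h3]
  exact h

theorem exists_norm_pow_le {V : Type*} [NormedRing V] [NormedAlgebra ℂ V] [CompleteSpace V]
    [Nontrivial V] (a : V) (r : ℝ) (hr0 : 0 < r) (hr : ∀ z ∈ spectrum ℂ a, ‖z‖ < r) :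
    ∃ q : ℝ, 0 < q ∧ q < r ∧ ∃ C : ℝ, 0 < C ∧ ∀ k : ℕ, ‖a ^ k‖ ≤ C * q ^ k := by
  have hs := spectrum.spectralRadius_lt_of_forall_lt a (r := ⟨r, hr0.le⟩) (fun z hz => hr z hz)
  obtain ⟨q, hq1, hq2⟩ := ENNReal.lt_iff_exists_nnreal_btwn.1 hs
  have hq0 : 0 < q := by
    rw [← ENNReal.coe_pos]; exact zero_le.trans_lt hq1
  have hq0' : (0 : ℝ) < q := hq0
  refine ⟨q, hq0, ENNReal.coe_lt_coe.1 hq2, ?_⟩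
  have hev := (spectrum.pow_nnnorm_pow_one_div_tendsto_nhds_spectralRadius a).eventually_lt_const hq1
  have hO : (fun k : ℕ => a ^ k) =O[atTop] fun k : ℕ => (q : ℝ) ^ k := by
    refine Asymptotics.IsBigO.of_bound 1 ?_
    filter_upwards [hev, eventually_gt_atTop 0] with k hk hk0
    have hk' : (‖a ^ k‖₊ : ℝ≥0∞) ≤ (q : ℝ≥0∞) ^ (k : ℝ) := by
      rw [one_div, ENNReal.rpow_inv_lt_iff (by positivity)] at hk
      exact hk.le
    rw [ENNReal.rpow_natCast] at hk'
    have : ‖a ^ k‖₊ ≤ q ^ k := by exact_mod_cast hk'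
    have : ‖a ^ k‖ ≤ q ^ k := by exact_mod_cast this
    simpa using this
  obtain ⟨C, hC, hb⟩ := Asymptotics.bound_of_isBigO_nat_atTop hO
  refine ⟨C, hC, fun k => ?_⟩
  have := hb (x := k) (by positivity)
  simpa [abs_of_pos hq0'] using this

section Flow

variable {V : Type*} [NormedAddCommGroup V] [NormedSpace ℝ V]

/-- The one-parameter group `t ↦ exp (t A)`, i.e. `(e ^ t) ^ A`. -/
def expFlow (A : V →L[ℝ] V) (t : ℝ) : V →L[ℝ] V := NormedSpace.exp (t • A)

theorem expFlow_zero (A : V →L[ℝ] V) : expFlow A 0 = 1 := by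
  simp [expFlow]

theorem expFlow_neg_left (A : V →L[ℝ] V) (t : ℝ) : expFlow (-A) t = expFlow A (-t) := by
  simp [expFlow]

variable [FiniteDimensional ℝ V]

theorem continuous_expFlow (A : V →L[ℝ] V) : Continuous (expFlow A) := by
  have : CompleteSpace V := FiniteDimensional.complete ℝ V
  let _ : NormedAlgebra ℚ (V →L[ℝ] V) := NormedAlgebra.restrictScalars ℚ ℝ _
  exact NormedSpace.exp_continuous.comp (continuous_id.smul continuous_const)

theorem expFlow_add (A : V →L[ℝ] V) (s t : ℝ) :
    expFlow A (s + t) = expFlow A s * expFlow A t := by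
  have : CompleteSpace V := FiniteDimensional.complete ℝ V
  let _ : NormedAlgebra ℚ (V →L[ℝ] V) := NormedAlgebra.restrictScalars ℚ ℝ _
  rw [expFlow, add_smul, NormedSpace.exp_add_of_commute]
  · rfl
  · exact ((Commute.refl A).smul_right _).smul_left _

theorem expFlow_add_apply (A : V →L[ℝ] V) (s t : ℝ) (x : V) :
    expFlow A (s + t) x = expFlow A s (expFlow A t x) := by
  rw [expFlow_add]; rfl

theorem expFlow_neg_apply_self (A : V →L[ℝ] V) (t : ℝ) (x : V) :
    expFlow A (-t) (expFlow A t x) = x := by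
  rw [← expFlow_add_apply, neg_add_cancel, expFlow_zero]; rfl

theorem expFlow_apply_neg_self (A : V →L[ℝ] V) (t : ℝ) (x : V) :
    expFlow A t (expFlow A (-t) x) = x := by
  rw [← expFlow_add_apply, add_neg_cancel, expFlow_zero]; rfl

theorem expFlow_natCast (A : V →L[ℝ] V) (k : ℕ) : expFlow A k = expFlow A 1 ^ k := by
  induction k with
  | zero => simp [expFlow_zero]
  | succ k ih => rw [Nat.cast_succ, expFlow_add, ih, pow_succ]

theorem expFlow_sub_smul_id (A : V →L[ℝ] V) (c t : ℝ) :
    expFlow (A - c • ContinuousLinearMap.id ℝ V) t = Real.exp (-(c * t)) • expFlow A t := by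
  have : CompleteSpace V := FiniteDimensional.complete ℝ V
  let _ : NormedAlgebra ℚ (V →L[ℝ] V) := NormedAlgebra.restrictScalars ℚ ℝ _
  have e : t • (A - c • ContinuousLinearMap.id ℝ V) =
      t • A + algebraMap ℝ (V →L[ℝ] V) (-(c * t)) := by
    rw [Algebra.algebraMap_eq_smul_one, smul_sub, smul_smul, neg_smul, sub_eq_add_neg, mul_comm]
    rfl
  rw [expFlow, e, NormedSpace.exp_add_of_commute (Algebra.commutes _ _).symm,
    ← NormedSpace.algebraMap_exp_comm, ← Real.exp_eq_exp_ℝ, Algebra.algebraMap_eq_smul_one,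
    mul_smul_comm, mul_one]
  rfl

theorem hasDerivAt_expFlow (A : V →L[ℝ] V) (t : ℝ) :
    HasDerivAt (expFlow A) (expFlow A t * A) t := by
  have : CompleteSpace V := FiniteDimensional.complete ℝ V
  exact hasDerivAt_exp_smul_const (𝕂 := ℝ) A t

theorem exists_norm_expFlow_le_of_mem_Icc (A : V →L[ℝ] V) (a b : ℝ) :
    ∃ C : ℝ, 0 < C ∧ ∀ t ∈ Set.Icc a b, ‖expFlow A t‖ ≤ C := by
  obtain ⟨C, hC⟩ := (isCompact_Icc (a := a) (b := b)).bddAbove_image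
    (continuous_expFlow A).norm.continuousOn
  exact ⟨max C 1, by positivity, fun t ht => (hC ⟨t, ht, rfl⟩).trans (le_max_left _ _)⟩

/-- Jacobi's formula for the exponential. -/
theorem det_expFlow (A : V →L[ℝ] V) (t : ℝ) :
    LinearMap.det (expFlow A t : V →ₗ[ℝ] V) =
      Real.exp (t * LinearMap.trace ℝ V (A : V →ₗ[ℝ] V)) := by
  set q := LinearMap.trace ℝ V (A : V →ₗ[ℝ] V) with hq
  set b := Module.finBasis ℝ V
  set f : (V →L[ℝ] V) → ℝ := fun B => LinearMap.det (B : V →ₗ[ℝ] V) with hf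
  have hfmul : ∀ B B', f (B * B') = f B * f B' := fun B B' => LinearMap.det_comp _ _
  have hdiff : Differentiable ℝ f := by
    have : f = fun B : V →L[ℝ] V => ∑ σ : Equiv.Perm (Fin (Module.finrank ℝ V)), ((Equiv.Perm.sign σ : ℤ) : ℝ) *
        ∏ i, (LinearMap.toContinuousLinearMap (b.coord (σ i))) (B (b i)) := by
      funext B
      rw [hf]
      simp only
      rw [← LinearMap.det_toMatrix b, Matrix.det_apply']
      simp [LinearMap.toMatrix_apply]
    rw [this]
    fun_prop
  have hline : HasDerivAt (fun t : ℝ => f (1 + t • A)) (q) 0 := by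
    set M := LinearMap.toMatrix b b (A : V →ₗ[ℝ] V)
    set p := (Matrix.det (1 + (Polynomial.X : Polynomial ℝ) • M.map Polynomial.C)).divX.divX
    have e : (fun t : ℝ => f (1 + t • A)) = fun t => 1 + q * t + p.eval t * t ^ 2 := by
      funext t
      rw [hf]
      simp only
      rw [← LinearMap.det_toMatrix b]
      have : LinearMap.toMatrix b b ((1 + t • A : V →L[ℝ] V) : V →ₗ[ℝ] V) = 1 + t • M := by
        rw [ContinuousLinearMap.toLinearMap_add, map_add, ContinuousLinearMap.toLinearMap_smul, map_smul]
        congr 1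
        exact LinearMap.toMatrix_one b
      rw [this, Matrix.det_one_add_smul, hq, LinearMap.trace_eq_matrix_trace ℝ b]
    rw [e]
    have h1 : HasDerivAt (fun t : ℝ => 1 + q * t + p.eval t * t ^ 2)
      (0 + q * 1 + (p.derivative.eval 0 * 0 ^ 2 + p.eval 0 * (2 * 0 ^ 1))) 0 := by
      refine (((hasDerivAt_const 0 (1 : ℝ)).add ((hasDerivAt_id (0 : ℝ)).const_mul (q)))).add
        ((p.hasDerivAt 0).mul ?_)
      simpa using hasDerivAt_pow 2 (0 : ℝ)
    simpa using h1
  have hf1 : HasDerivAt (fun t : ℝ => f (expFlow A t)) (q) 0 := by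
    have h1 : HasDerivAt (fun t : ℝ => expFlow A t) A 0 := by
      simpa [expFlow_zero] using hasDerivAt_expFlow A 0
    have h2 : HasDerivAt (fun t : ℝ => (1 : V →L[ℝ] V) + t • A) A 0 := by
      simpa using ((hasDerivAt_id (0 : ℝ)).smul_const A).const_add (1 : V →L[ℝ] V)
    have h3 := (hdiff (1 : V →L[ℝ] V)).hasFDerivAt
    have h4 : HasDerivAt (fun t : ℝ => f (1 + t • A)) (fderiv ℝ f 1 A) 0 := by
      refine HasFDerivAt.comp_hasDerivAt (l := f) (0 : ℝ) ?_ h2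
      simpa using h3
    have h5 : HasDerivAt (fun t : ℝ => f (expFlow A t)) (fderiv ℝ f 1 A) 0 := by
      refine HasFDerivAt.comp_hasDerivAt (l := f) (0 : ℝ) ?_ h1
      simpa [expFlow_zero] using h3
    rwa [h4.unique hline] at h5
  have hft : ∀ t, HasDerivAt (fun t : ℝ => f (expFlow A t))
      (f (expFlow A t) * q) t := by
    intro t
    have h1 : HasDerivAt (fun s : ℝ => f (expFlow A s)) (q) (t - t) := by
      rwa [sub_self]
    have h2 := (h1.comp_sub_const t t).const_mul (f (expFlow A t))
    refine h2.congr_of_eventuallyEq (Eventually.of_forall fun s => ?_)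
    simp only
    rw [← hfmul, ← expFlow_add, add_sub_cancel]
  have hg : ∀ t, HasDerivAt (fun t : ℝ => f (expFlow A t) * Real.exp (-(t * q)))
      0 t := by
    intro t
    have h1 : HasDerivAt (fun t : ℝ => Real.exp (-(t * q))) (Real.exp (-(t * q)) * -(1 * q)) t :=
      ((hasDerivAt_id t).mul_const q).neg.exp
    refine ((hft t).mul h1).congr_deriv ?_
    ring
  have hconst := is_const_of_deriv_eq_zero (fun t => (hg t).differentiableAt)
    (fun t => (hg t).deriv) t 0
  have hone : f 1 = 1 := LinearMap.det_id
  simp only [expFlow_zero, zero_mul, neg_zero, Real.exp_zero, mul_one, hone] at hconst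
  rw [Real.exp_neg] at hconst
  exact eq_of_mul_inv_eq_one hconst

/-- Geometric growth of the powers of `exp A` gives exponential growth of `exp (t A)`. -/
theorem exists_norm_expFlow_le_of_pow (A : V →L[ℝ] V) {q C₁ : ℝ} (hq0 : 0 < q) (hC₁ : 0 < C₁)
    (hb : ∀ k : ℕ, ‖expFlow A 1 ^ k‖ ≤ C₁ * q ^ k) :
    ∃ C : ℝ, 0 < C ∧ ∀ s : ℝ, 0 ≤ s → ‖expFlow A s‖ ≤ C * Real.exp (Real.log q * s) := by
  obtain ⟨C₂, hC₂0, hC₂⟩ := exists_norm_expFlow_le_of_mem_Icc A 0 1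
  set c' := Real.log q with hc'
  refine ⟨C₁ * C₂ * Real.exp |c'|, by positivity, fun s hs => ?_⟩
  set k := ⌊s⌋₊
  have hk1 : (k : ℝ) ≤ s := Nat.floor_le hs
  have hk2 : s < k + 1 := Nat.lt_floor_add_one s
  have hsplit : expFlow A s = expFlow A 1 ^ k * expFlow A (s - k) := by
    rw [← expFlow_natCast, ← expFlow_add, add_sub_cancel]
  have h2 : ‖expFlow A (s - k)‖ ≤ C₂ :=
    hC₂ _ ⟨by linarith, by linarith⟩
  have h3 : q ^ k ≤ Real.exp (c' * s) * Real.exp |c'| := by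
    have : q ^ k = Real.exp (c' * k) := by
      rw [mul_comm, Real.exp_nat_mul, hc', Real.exp_log hq0]
    rw [this, ← Real.exp_add]
    apply Real.exp_le_exp.2
    have : c' * k - c' * s ≤ |c'| * 1 := by
      rw [← mul_sub]
      refine (le_abs_self _).trans ?_
      rw [abs_mul]
      exact mul_le_mul_of_nonneg_left (abs_le.2 ⟨by linarith, by linarith⟩) (abs_nonneg _)
    linarith
  calc _ ≤ ‖expFlow A 1 ^ k‖ * ‖expFlow A (s - k)‖ := by
        rw [hsplit]; exact norm_mul_le _ _
    _ ≤ (C₁ * q ^ k) * C₂ := by gcongr; exact hb k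
    _ ≤ (C₁ * (Real.exp (c' * s) * Real.exp |c'|)) * C₂ := by gcongr
    _ = _ := by ring


end Flow

theorem exists_norm_expFlow_one_pow_le {n : ℕ} (hn : 0 < n) (A : Op n) (c : ℝ)
    (h : ∀ z, IsEigenvalue A z → z.re < c) :
    ∃ q : ℝ, 0 < q ∧ q < Real.exp c ∧ ∃ C : ℝ, 0 < C ∧
      ∀ k : ℕ, ‖expFlow A 1 ^ k‖ ≤ C * q ^ k := by
  have : Nonempty (Fin n) := ⟨⟨0, hn⟩⟩
  have : Nontrivial (Cn n) := inferInstance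
  have hexp : complexify n (expFlow A 1) = NormedSpace.exp (complexify n A) := by
    let _ : NormedAlgebra ℚ (Op n) := NormedAlgebra.restrictScalars ℚ ℝ (Op n)
    have h1 : expFlow A 1 = NormedSpace.exp A := congrArg NormedSpace.exp (one_smul ℝ A)
    rw [h1, NormedSpace.map_exp (complexify n) (complexify_continuous n)]
  obtain ⟨q, hq0, hqr, C₁, hC₁, hb⟩ := exists_norm_pow_le (complexify n (expFlow A 1))
    (Real.exp c) (Real.exp_pos c) (by
      intro z hz
      rw [hexp] at hz
      obtain ⟨w, hw, rfl⟩ := exists_eigenvalue_of_mem_spectrum_exp _ hz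
      rw [Complex.norm_exp]
      exact Real.exp_lt_exp.2 (h w (isEigenvalue_of_complexify hw)))
  obtain ⟨K, hK0, hK⟩ := (complexify n).toLinearMap.exists_antilipschitzWith
    (LinearMap.ker_eq_bot.2 (complexify_injective n))
  refine ⟨q, hq0, hqr, K * C₁, mul_pos hK0 hC₁, fun k => ?_⟩
  have h1 := hK.le_mul_dist (expFlow A 1 ^ k) 0
  rw [map_zero, dist_zero_right, dist_zero_right] at h1
  rw [mul_assoc]
  refine h1.trans (mul_le_mul_of_nonneg_left ?_ K.2)
  have e : (complexify n).toLinearMap (expFlow A 1 ^ k) =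
    complexify n (expFlow A 1) ^ k := map_pow (complexify n) _ _
  rw [e]
  exact hb k

/-- If all eigenvalues of `A` have real part less than `c`, then `exp (s A)` grows at a rate
strictly less than `exp (c s)`. -/
theorem exists_norm_expFlow_le {n : ℕ} (hn : 0 < n) (A : Op n) (c : ℝ)
    (h : ∀ z, IsEigenvalue A z → z.re < c) :
    ∃ c' < c, ∃ C : ℝ, 0 < C ∧ ∀ s : ℝ, 0 ≤ s → ‖expFlow A s‖ ≤ C * Real.exp (c' * s) := by
  obtain ⟨q, hq0, hqr, C₁, hC₁, hb⟩ := exists_norm_expFlow_one_pow_le hn A c h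
  exact ⟨Real.log q, by rwa [Real.log_lt_iff_lt_exp hq0],
    exists_norm_expFlow_le_of_pow A hq0 hC₁ hb⟩

/-- The flow of an operator in `Q(ℝⁿ)` contracts exponentially backwards in time. -/
theorem exists_norm_expFlow_neg_le {n : ℕ} (hn : 0 < n) {A : Op n} (hA : A ∈ Q n) :
    ∃ a > 0, ∃ C : ℝ, 0 < C ∧ ∀ s : ℝ, 0 ≤ s → ‖expFlow A (-s)‖ ≤ C * Real.exp (-a * s) := by
  obtain ⟨c', hc', C, hC, hb⟩ := exists_norm_expFlow_le hn (-A) 0 (by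
    intro z hz
    have : IsEigenvalue A (-z) := by
      obtain ⟨v, hv⟩ := hz.exists_hasEigenvector
      refine Module.End.hasEigenvalue_of_hasEigenvector (x := v)
        ⟨Module.End.mem_eigenspace_iff.2 ?_, hv.2⟩
      have h1 := hv.apply_eq_smul
      rw [ContinuousLinearMap.toLinearMap_neg, LinearMap.baseChange_neg, LinearMap.neg_apply] at h1
      rw [neg_smul, ← h1, neg_neg]
    have := hA.2 _ this
    simpa using this)
  refine ⟨-c', by linarith, C, hC, fun s hs => ?_⟩
  rw [neg_neg, ← expFlow_neg_left]
  exact hb s hs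


theorem ENNReal_add_rpow_le {α : ℝ} (hα : 0 < α) (a b : ℝ≥0∞) :
    (a + b) ^ α ≤ 2 ^ α * (a ^ α + b ^ α) := by
  have h : a + b ≤ 2 * max a b := by
    rw [two_mul]; exact add_le_add (le_max_left _ _) (le_max_right _ _)
  calc (a + b) ^ α ≤ (2 * max a b) ^ α := ENNReal.rpow_le_rpow h hα.le
    _ = 2 ^ α * (max a b) ^ α := ENNReal.mul_rpow_of_nonneg _ _ hα.le
    _ ≤ _ := by
      gcongr
      rcases le_total a b with hab | hab
      · rw [max_eq_right hab]; exact le_add_self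
      · rw [max_eq_left hab]; exact le_self_add

theorem enorm_sub_rpow_le {α : ℝ} (hα : 0 < α) {V : Type*} [NormedAddCommGroup V] (a b : V) :
    ‖a - b‖ₑ ^ α ≤ 2 ^ α * (‖a‖ₑ ^ α + ‖b‖ₑ ^ α) :=
  (ENNReal.rpow_le_rpow (enorm_sub_le) hα.le).trans (ENNReal_add_rpow_le hα _ _)

theorem enorm_add_rpow_le {α : ℝ} (hα : 0 < α) {V : Type*} [NormedAddCommGroup V] (a b : V) :
    ‖a + b‖ₑ ^ α ≤ 2 ^ α * (‖a‖ₑ ^ α + ‖b‖ₑ ^ α) :=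
  (ENNReal.rpow_le_rpow (enorm_add_le _ _) hα.le).trans (ENNReal_add_rpow_le hα _ _)

theorem enorm_mul_rpow_le {α : ℝ} (hα : 0 < α) {R : Type*} [NormedRing R] (a b : R) :
    ‖a * b‖ₑ ^ α ≤ ‖a‖ₑ ^ α * ‖b‖ₑ ^ α := by
  rw [← ENNReal.mul_rpow_of_nonneg _ _ hα.le]
  refine ENNReal.rpow_le_rpow ?_ hα.le
  simp only [enorm_eq_nnnorm, ← ENNReal.coe_mul, ENNReal.coe_le_coe]
  exact nnnorm_mul_le a b

theorem tsum_ofReal_exp_neg_lt_top {C b : ℝ} (hb : 0 < b) :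
    ∑' j : ℕ, ENNReal.ofReal (C * Real.exp (-b * j)) < ∞ := by
  have hs : Summable fun j : ℕ => C * Real.exp (-b * j) := by
    refine Summable.mul_left _ ?_
    have := summable_geometric_of_lt_one (Real.exp_pos (-b)).le (by rw [Real.exp_lt_one_iff]; linarith)
    refine this.congr fun j => ?_
    rw [← Real.exp_nat_mul, mul_comm]
  exact hs.tsum_ofReal_lt_top

theorem enorm_rpow_le_ofReal {V : Type*} [NormedAddCommGroup V] {α : ℝ} (hα : 0 < α) {v : V}
    {c : ℝ} (h : ‖v‖ ≤ c) : ‖v‖ₑ ^ α ≤ ENNReal.ofReal (c ^ α) := by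
  rw [← ENNReal.ofReal_rpow_of_nonneg ((norm_nonneg v).trans h) hα.le, ← ofReal_norm]
  exact ENNReal.rpow_le_rpow (ENNReal.ofReal_le_ofReal h) hα.le

section Flow

variable {V : Type*} [NormedAddCommGroup V] [NormedSpace ℝ V] [FiniteDimensional ℝ V]

theorem expFlow_injective (A : V →L[ℝ] V) (t : ℝ) : Function.Injective (expFlow A t) :=
  Function.LeftInverse.injective (g := expFlow A (-t)) (expFlow_neg_apply_self A t)

theorem setLIntegral_image_expFlow [MeasurableSpace V] [BorelSpace V] (μ : Measure V)
    [μ.IsAddHaarMeasure] (A : V →L[ℝ] V) (t : ℝ) {S : Set V} (hS : MeasurableSet S)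
    (f : V → ℝ≥0∞) :
    ∫⁻ y in expFlow A t '' S, f y ∂μ =
      ENNReal.ofReal (Real.exp (t * LinearMap.trace ℝ V (A : V →ₗ[ℝ] V))) *
        ∫⁻ y in S, f (expFlow A t y) ∂μ := by
  rw [lintegral_image_eq_lintegral_abs_det_fderiv_mul μ hS
    (fun x _ => (expFlow A t).hasFDerivAt.hasFDerivWithinAt) (expFlow_injective A t).injOn,
    ← lintegral_const_mul' _ _ ENNReal.ofReal_ne_top]
  refine lintegral_congr fun y => ?_
  rw [ContinuousLinearMap.det, det_expFlow, abs_of_pos (Real.exp_pos _)]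

theorem lintegral_expFlow [MeasurableSpace V] [BorelSpace V] (μ : Measure V)
    [μ.IsAddHaarMeasure] (A : V →L[ℝ] V) (t : ℝ) (f : V → ℝ≥0∞) :
    ∫⁻ y, f y ∂μ =
      ENNReal.ofReal (Real.exp (t * LinearMap.trace ℝ V (A : V →ₗ[ℝ] V))) *
        ∫⁻ y, f (expFlow A t y) ∂μ := by
  have := setLIntegral_image_expFlow μ A t MeasurableSet.univ f
  rwa [Set.image_univ, (Function.RightInverse.surjective (expFlow_apply_neg_self A t)).range_eq,
    Measure.restrict_univ] at this

/-- `s ↦ s ^ A` is Lipschitz on compact subintervals of `(0, ∞)`. -/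
theorem exists_norm_expFlow_log_sub_le (A : V →L[ℝ] V) {p P : ℝ} (hp : 0 < p) :
    ∃ C : ℝ, 0 < C ∧ ∀ s ∈ Set.Icc p P, ∀ t ∈ Set.Icc p P,
      ‖expFlow A (Real.log s) - expFlow A (Real.log t)‖ ≤ C * |s - t| := by
  obtain ⟨C, hC, hb⟩ := exists_norm_expFlow_le_of_mem_Icc A (Real.log p) (Real.log P)
  refine ⟨p⁻¹ * (C * (‖A‖ + 1)), by positivity, fun s hs t ht => ?_⟩
  refine (convex_Icc p P).norm_image_sub_le_of_norm_hasDerivWithin_le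
    (f := fun s => expFlow A (Real.log s))
    (f' := fun s => s⁻¹ • (expFlow A (Real.log s) * A)) (fun x hx => ?_) (fun x hx => ?_) ht hs
  · have hx0 : x ≠ 0 := (hp.trans_le hx.1).ne'
    exact ((hasDerivAt_expFlow A (Real.log x)).scomp x (Real.hasDerivAt_log hx0)).hasDerivWithinAt
  · have hx0 : 0 < x := hp.trans_le hx.1
    rw [norm_smul, norm_inv, Real.norm_eq_abs, abs_of_pos hx0]
    have h1 : ‖expFlow A (Real.log x)‖ ≤ C :=
      hb _ ⟨Real.log_le_log hp hx.1, Real.log_le_log hx0 hx.2⟩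
    have h2 : ‖expFlow A (Real.log x) * A‖ ≤ C * (‖A‖ + 1) :=
      (norm_mul_le _ _).trans (mul_le_mul h1 (by linarith) (norm_nonneg _) hC.le)
    have h3 : x⁻¹ ≤ p⁻¹ := inv_anti₀ hp hx.1
    exact mul_le_mul h3 h2 (norm_nonneg _) (by positivity)

theorem tendsto_expFlow_neg_apply {A : V →L[ℝ] V}
    (hA : ∃ a > 0, ∃ C : ℝ, 0 < C ∧ ∀ s : ℝ, 0 ≤ s → ‖expFlow A (-s)‖ ≤ C * Real.exp (-a * s)) :
    Tendsto (fun s => ‖expFlow A (-s)‖) atTop (𝓝 0) := by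
  obtain ⟨a, ha, C, hC, hb⟩ := hA
  have h1 : Tendsto (fun s : ℝ => C * Real.exp (-a * s)) atTop (𝓝 (C * 0)) := by
    refine Tendsto.const_mul _ (Real.tendsto_exp_atBot.comp ?_)
    exact tendsto_id.const_mul_atTop_of_neg (by linarith)
  rw [mul_zero] at h1
  refine squeeze_zero' (Eventually.of_forall fun s => norm_nonneg _) ?_ h1
  filter_upwards [eventually_ge_atTop 0] with s hs using hb s hs

/-- The fundamental shell of the group `k ↦ exp (k A)`. -/
def shell (A : V →L[ℝ] V) : Set V := {y | (‖expFlow A 1‖ + 1)⁻¹ ≤ ‖y‖ ∧ ‖y‖ ≤ 1}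

theorem isCompact_shell (A : V →L[ℝ] V) : IsCompact (shell A) := by
  have : ProperSpace V := FiniteDimensional.proper ℝ V
  have h : shell A = {y | (‖expFlow A 1‖ + 1)⁻¹ ≤ ‖y‖} ∩ Metric.closedBall 0 1 := by
    ext y; simp [shell]
  rw [h]
  exact (isCompact_closedBall 0 1).inter_left (isClosed_le continuous_const continuous_norm)

theorem ne_zero_of_mem_shell {A : V →L[ℝ] V} {y : V} (hy : y ∈ shell A) : y ≠ 0 := by
  have h : 0 < (‖expFlow A 1‖ + 1)⁻¹ := by positivity
  exact norm_pos_iff.1 (h.trans_le hy.1)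

theorem exists_expFlow_mem_shell {A : V →L[ℝ] V}
    (hA : ∃ a > 0, ∃ C : ℝ, 0 < C ∧ ∀ s : ℝ, 0 ≤ s → ‖expFlow A (-s)‖ ≤ C * Real.exp (-a * s))
    {y : V} (hy : y ≠ 0) : ∃ k : ℤ, expFlow A (-(k : ℝ)) y ∈ shell A := by
  have hlim := tendsto_expFlow_neg_apply hA
  have hy0 : 0 < ‖y‖ := norm_pos_iff.2 hy
  have h1 : ∃ k : ℤ, ‖expFlow A (-(k : ℝ)) y‖ ≤ 1 := by
    have := (hlim.comp tendsto_natCast_atTop_atTop).eventually_lt_const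
      (show (0 : ℝ) < ‖y‖⁻¹ by positivity)
    obtain ⟨k, hk⟩ := this.exists
    refine ⟨k, ((expFlow A (-(((k : ℤ)) : ℝ))).le_opNorm y).trans ?_⟩
    have hk' : ‖expFlow A (-(((k : ℤ)) : ℝ))‖ ≤ ‖y‖⁻¹ := by simpa using hk.le
    calc _ ≤ ‖y‖⁻¹ * ‖y‖ := by gcongr
      _ = 1 := inv_mul_cancel₀ hy0.ne'
  have h2 : ∃ b : ℤ, ∀ z : ℤ, ‖expFlow A (-(z : ℝ)) y‖ ≤ 1 → b ≤ z := by
    have := hlim.eventually_lt_const hy0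
    obtain ⟨N, hN⟩ := eventually_atTop.1 this
    refine ⟨-⌈N⌉, fun z hz => ?_⟩
    by_contra! hlt
    have hzN : N ≤ -(z : ℝ) := by
      have : (⌈N⌉ : ℝ) < -(z : ℝ) := by
        have : ⌈N⌉ < -z := by omega
        exact_mod_cast this
      linarith [Int.le_ceil N]
    have h3 := hN _ hzN
    have h4 : ‖y‖ ≤ ‖expFlow A (- -(z : ℝ))‖ * ‖expFlow A (-(z : ℝ)) y‖ := by
      conv_lhs => rw [← expFlow_neg_apply_self A (-(z : ℝ)) y]
      exact (expFlow A _).le_opNorm _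
    have h5 : ‖expFlow A (- -(z : ℝ))‖ * ‖expFlow A (-(z : ℝ)) y‖ ≤ ‖expFlow A (- -(z : ℝ))‖ * 1 := by
      gcongr
    linarith
  obtain ⟨k, hk, hmin⟩ := Int.exists_least_of_bdd h2 h1
  refine ⟨k, ?_, hk⟩
  have h6 : 1 < ‖expFlow A (-((k - 1 : ℤ) : ℝ)) y‖ := by
    by_contra! h
    have := hmin _ h
    omega
  have h7 : expFlow A (-((k - 1 : ℤ) : ℝ)) y = expFlow A 1 (expFlow A (-(k : ℝ)) y) := by
    rw [← expFlow_add_apply]; congr 2; push_cast; ring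
  rw [h7] at h6
  have h8 := (expFlow A 1).le_opNorm (expFlow A (-(k : ℝ)) y)
  rw [inv_le_iff_one_le_mul₀ (by positivity)]
  nlinarith [norm_nonneg (expFlow A (-(k : ℝ)) y)]

end Flow

/-- The properties of the exponents, of the radial part `τ` and of the function `φ` on which the
integrability of the moving-average kernel depends. -/
structure KernelData {V W : Type*} [NormedAddCommGroup V] [NormedSpace ℝ V]
    [NormedAddCommGroup W] [NormedSpace ℝ W] (E : V →L[ℝ] V) (D : W →L[ℝ] W) (β : ℝ)
    (τ φ : V → ℝ) : Prop where
  contract_left : ∃ a > 0, ∃ C : ℝ, 0 < C ∧ ∀ s : ℝ, 0 ≤ s →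
    ‖expFlow E (-s)‖ ≤ C * Real.exp (-a * s)
  contract_right : ∃ a > 0, ∃ C : ℝ, 0 < C ∧ ∀ s : ℝ, 0 ≤ s →
    ‖expFlow D (-s)‖ ≤ C * Real.exp (-a * s)
  growth_right : ∃ c < β, ∃ C : ℝ, 0 < C ∧ ∀ s : ℝ, 0 ≤ s →
    ‖expFlow D s‖ ≤ C * Real.exp (c * s)
  pos_exponent : 0 < β
  radial_nonneg : ∀ x, 0 ≤ τ x
  radial_expFlow : ∀ t x, τ (expFlow E t x) = Real.exp t * τ x
  radial_bounded : ∃ T : ℝ, 0 < T ∧ ∀ x, ‖x‖ ≤ 1 → τ x ≤ T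
  pos : ∀ x, x ≠ 0 → 0 < φ x
  hom : ∀ t x, x ≠ 0 → φ (expFlow E t x) = Real.exp t * φ x
  adm : ∀ A B : ℝ, 0 < A → A < B → ∃ C : ℝ, 0 < C ∧
    ∀ x y : V, A ≤ ‖y‖ → ‖y‖ ≤ B → τ x ≤ 1 → |φ (x + y) - φ y| ≤ C * τ x ^ β

namespace KernelData

variable {V W : Type*} [NormedAddCommGroup V] [NormedSpace ℝ V] [FiniteDimensional ℝ V]
  [NormedAddCommGroup W] [NormedSpace ℝ W] [FiniteDimensional ℝ W]
  {E : V →L[ℝ] V} {D : W →L[ℝ] W} {β : ℝ} {τ φ : V → ℝ}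

theorem tendsto_radial (h : KernelData E D β τ φ) : Tendsto τ (𝓝 0) (𝓝 0) := by
  obtain ⟨T, hT, hb⟩ := h.radial_bounded
  rw [Metric.tendsto_nhds]
  intro ε hε
  set t := Real.log (2 * T / ε)
  have hcont : Tendsto (fun x => ‖expFlow E t x‖) (𝓝 0) (𝓝 0) := by
    have := ((expFlow E t).continuous.norm).tendsto 0
    simpa using this
  filter_upwards [hcont.eventually_le_const one_pos] with x hx
  have h1 := hb _ hx
  rw [h.radial_expFlow, Real.exp_log (by positivity)] at h1
  rw [Real.dist_eq, sub_zero, abs_of_nonneg (h.radial_nonneg x)]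
  rw [div_mul_eq_mul_div, div_le_iff₀ hε] at h1
  nlinarith

theorem continuousAt (h : KernelData E D β τ φ) {y : V} (hy : y ≠ 0) : ContinuousAt φ y := by
  have hy0 : 0 < ‖y‖ := norm_pos_iff.2 hy
  obtain ⟨C, hC, hb⟩ := h.adm ‖y‖ (2 * ‖y‖) hy0 (by linarith)
  have h0 : Tendsto (fun z => z - y) (𝓝 y) (𝓝 0) := by
    have : Continuous fun z : V => z - y := by fun_prop
    simpa using this.tendsto y
  have h1 : Tendsto (fun z => τ (z - y)) (𝓝 y) (𝓝 0) := h.tendsto_radial.comp h0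
  have h2 : Tendsto (fun z => C * τ (z - y) ^ β) (𝓝 y) (𝓝 0) := by
    have := (h1.rpow_const (p := β) (Or.inr h.pos_exponent.le)).const_mul C
    rwa [Real.zero_rpow h.pos_exponent.ne', mul_zero] at this
  rw [ContinuousAt, tendsto_iff_dist_tendsto_zero]
  refine squeeze_zero' (Eventually.of_forall fun z => dist_nonneg) ?_ h2
  filter_upwards [h1.eventually_le_const one_pos] with z hz
  have := hb (z - y) y le_rfl (by linarith) hz
  rwa [sub_add_cancel] at this

theorem continuousOn (h : KernelData E D β τ φ) {S : Set V} (hS : ∀ y ∈ S, y ≠ 0) :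
    ContinuousOn φ S :=
  fun y hy => (h.continuousAt (hS y hy)).continuousWithinAt

theorem measurable [MeasurableSpace V] [BorelSpace V] (h : KernelData E D β τ φ) :
    Measurable φ := by
  have h1 : ContinuousOn φ {0}ᶜ := h.continuousOn (fun y hy => hy)
  classical
  have h2 : φ = fun x => if x = 0 then φ 0 else φ x := by
    funext x; split_ifs with hx
    · rw [hx]
    · rfl
  have h3 : Measurable (Set.piecewise ({0}ᶜ : Set V) φ (fun _ => φ 0)) :=
    h1.measurable_piecewise continuousOn_const (measurableSet_singleton (0 : V)).compl
  convert h3 using 1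
  funext x
  by_cases hx : x = 0 <;> simp [Set.piecewise, hx]

/-- The power `φ(y) ^ (D - c I)`. -/
def _root_.OSS.powKernel (D : W →L[ℝ] W) (c : ℝ) (φ : V → ℝ) (y : V) : W →L[ℝ] W :=
  expFlow (D - c • ContinuousLinearMap.id ℝ W) (Real.log (φ y))

theorem powKernel_expFlow (h : KernelData E D β τ φ) (c t : ℝ) {y : V} (hy : y ≠ 0) :
    powKernel D c φ (expFlow E t y) =
      expFlow (D - c • ContinuousLinearMap.id ℝ W) t * powKernel D c φ y := by
  rw [powKernel, h.hom t y hy, Real.log_mul (Real.exp_pos t).ne' (h.pos y hy).ne', Real.log_exp,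
    expFlow_add]
  rfl

theorem measurable_powKernel [MeasurableSpace V] [BorelSpace V] (h : KernelData E D β τ φ)
    (c : ℝ) : Measurable (powKernel D c φ) :=
  (continuous_expFlow _).measurable.comp (Real.measurable_log.comp h.measurable)

theorem continuousOn_powKernel (h : KernelData E D β τ φ) (c : ℝ) {S : Set V}
    (hS : ∀ y ∈ S, y ≠ 0) : ContinuousOn (powKernel D c φ) S :=
  (continuous_expFlow _).comp_continuousOn
    ((h.continuousOn hS).log fun y hy => (h.pos y (hS y hy)).ne')

/-- Scaling of the powers of the shifted exponent against the Jacobian `exp (t q)`. -/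
theorem _root_.OSS.jacobian_mul_enorm_rpow {α : ℝ} (hα : 0 < α) (D : W →L[ℝ] W) (q t : ℝ) :
    ENNReal.ofReal (Real.exp (t * q)) *
      ‖expFlow (D - (q / α) • ContinuousLinearMap.id ℝ W) t‖ₑ ^ α = ‖expFlow D t‖ₑ ^ α := by
  have h : ‖expFlow (D - (q / α) • ContinuousLinearMap.id ℝ W) t‖ₑ =
      ENNReal.ofReal (Real.exp (-(q / α * t))) * ‖expFlow D t‖ₑ := by
    rw [expFlow_sub_smul_id, enorm_smul, Real.enorm_eq_ofReal (Real.exp_pos _).le]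
  rw [h, ENNReal.mul_rpow_of_nonneg _ _ hα.le, ← mul_assoc,
    ENNReal.ofReal_rpow_of_nonneg (Real.exp_pos _).le hα.le,
    ← ENNReal.ofReal_mul (Real.exp_pos _).le, ← Real.exp_mul, ← Real.exp_add]
  have : t * q + -(q / α * t) * α = 0 := by field_simp; ring
  rw [this, Real.exp_zero, ENNReal.ofReal_one, one_mul]

section Measure

variable [MeasurableSpace V] [BorelSpace V] (μ : Measure V) [μ.IsAddHaarMeasure] {α : ℝ}

/-- The trace of an operator, as an abbreviation for the homogeneous dimension. -/
abbrev _root_.OSS.homDim (E : V →L[ℝ] V) : ℝ := LinearMap.trace ℝ V (E : V →ₗ[ℝ] V)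

theorem setLIntegral_powKernel_lt_top (h : KernelData E D β τ φ) (hα : 0 < α) (c : ℝ) {S : Set V}
    (hSc : IsCompact S) (hS : ∀ y ∈ S, y ≠ 0) :
    ∫⁻ y in S, ‖powKernel D c φ y‖ₑ ^ α ∂μ < ∞ := by
  obtain ⟨C, hC⟩ := hSc.bddAbove_image (h.continuousOn_powKernel c hS).norm
  refine (setLIntegral_mono (g := fun _ => ENNReal.ofReal (C ^ α)) measurable_const fun y hy =>
    enorm_rpow_le_ofReal hα (hC ⟨y, hy, rfl⟩)).trans_lt ?_
  rw [setLIntegral_const]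
  exact ENNReal.mul_lt_top ENNReal.ofReal_lt_top hSc.measure_lt_top

theorem setLIntegral_shell_le (h : KernelData E D β τ φ) (hα : 0 < α) (t : ℝ) :
    ∫⁻ y in expFlow E t '' shell E, ‖powKernel D (homDim E / α) φ y‖ₑ ^ α ∂μ ≤
      ‖expFlow D t‖ₑ ^ α * ∫⁻ y in shell E, ‖powKernel D (homDim E / α) φ y‖ₑ ^ α ∂μ := by
  have hm := (isCompact_shell E).measurableSet
  rw [setLIntegral_image_expFlow μ E t hm, ← jacobian_mul_enorm_rpow hα D (homDim E) t, mul_assoc]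
  gcongr
  rw [← lintegral_const_mul _ ((h.measurable_powKernel _).enorm.pow_const α)]
  refine setLIntegral_mono' hm fun y hy => ?_
  rw [h.powKernel_expFlow _ t (ne_zero_of_mem_shell hy)]
  exact enorm_mul_rpow_le hα _ _

theorem setLIntegral_closedBall_lt_top [Nontrivial V] (h : KernelData E D β τ φ) (hα : 0 < α)
    (R : ℝ) :
    ∫⁻ y in Metric.closedBall 0 R, ‖powKernel D (homDim E / α) φ y‖ₑ ^ α ∂μ < ∞ := by
  obtain ⟨k₁, hk₁⟩ : ∃ k₁ : ℕ, ∀ s : ℝ, k₁ ≤ s → ∀ y : V, ‖y‖ ≤ R → expFlow E (-s) y ∉ shell E := by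
    have h1 := (tendsto_expFlow_neg_apply h.contract_left).eventually_lt_const
      (show 0 < (‖expFlow E 1‖ + 1)⁻¹ / (|R| + 1) by positivity)
    obtain ⟨N, hN⟩ := eventually_atTop.1 h1
    refine ⟨⌈N⌉₊, fun s hs y hy hmem => ?_⟩
    have h2 := hN s ((Nat.le_ceil N).trans hs)
    have h3 : ‖y‖ < |R| + 1 := by linarith [le_abs_self R]
    rw [lt_div_iff₀ (by positivity)] at h2
    have h4 := (expFlow E (-s)).le_opNorm y
    have h5 : ‖expFlow E (-s)‖ * ‖y‖ ≤ ‖expFlow E (-s)‖ * (|R| + 1) := by gcongr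
    linarith [hmem.1]
  set G : V → ℝ≥0∞ := fun y => ‖powKernel D (homDim E / α) φ y‖ₑ ^ α
  have hcover : Metric.closedBall (0 : V) R ⊆
      {0} ∪ ⋃ j : ℕ, expFlow E (k₁ - j) '' shell E := by
    intro y hy
    by_cases hy0 : y = 0
    · exact Or.inl hy0
    right
    obtain ⟨k, hk⟩ := exists_expFlow_mem_shell h.contract_left hy0
    have hklt : (k : ℝ) < k₁ := by
      by_contra! hle
      exact hk₁ k hle y (by simpa using hy) hk
    have hklt' : k < k₁ := by exact_mod_cast hklt
    refine Set.mem_iUnion.2 ⟨(k₁ - k).toNat, _, hk, ?_⟩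
    have : ((k₁ : ℝ) - ((k₁ - k).toNat : ℝ)) = k := by
      have : (((k₁ - k).toNat : ℤ) : ℝ) = ((k₁ - k : ℤ) : ℝ) := by
        rw [Int.toNat_of_nonneg (by omega)]
      rw [Int.cast_natCast] at this
      rw [this]; push_cast; ring
    rw [this, expFlow_apply_neg_self]
  obtain ⟨a, ha, C, hC, hb⟩ := h.contract_right
  have hJ := h.setLIntegral_powKernel_lt_top μ hα (homDim E / α) (isCompact_shell E)
    (fun y hy => ne_zero_of_mem_shell hy)
  set J := ∫⁻ y in shell E, G y ∂μ with hJdef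
  obtain ⟨C', hC'⟩ : ∃ C' : ℝ, ∀ j : ℕ, ‖expFlow D (k₁ - j)‖ ≤ C' * Real.exp (-a * j) := by
    refine ⟨‖expFlow D k₁‖ * C, fun j => ?_⟩
    rw [sub_eq_add_neg, expFlow_add, mul_assoc]
    exact (norm_mul_le _ _).trans (by gcongr; exact hb j (by positivity))
  have hC'0 : 0 ≤ C' := by
    have := (norm_nonneg _).trans (hC' 0)
    simpa using this
  calc ∫⁻ y in Metric.closedBall 0 R, G y ∂μ
      ≤ ∫⁻ y in {0} ∪ ⋃ j : ℕ, expFlow E (k₁ - j) '' shell E, G y ∂μ := lintegral_mono_set hcover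
    _ ≤ ∫⁻ y in {0}, G y ∂μ + ∫⁻ y in ⋃ j : ℕ, expFlow E (k₁ - j) '' shell E, G y ∂μ :=
        lintegral_union_le _ _ _
    _ = ∫⁻ y in ⋃ j : ℕ, expFlow E (k₁ - j) '' shell E, G y ∂μ := by
        rw [setLIntegral_measure_zero _ _ (measure_singleton 0), zero_add]
    _ ≤ ∑' j : ℕ, ∫⁻ y in expFlow E (k₁ - j) '' shell E, G y ∂μ := lintegral_iUnion_le _ _
    _ ≤ ∑' j : ℕ, ENNReal.ofReal (C' ^ α * Real.exp (-(a * α) * j)) * J := by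
        refine ENNReal.tsum_le_tsum fun j => (h.setLIntegral_shell_le μ hα _).trans ?_
        gcongr
        refine (enorm_rpow_le_ofReal hα (hC' j)).trans_eq ?_
        rw [Real.mul_rpow hC'0 (Real.exp_pos _).le, ← Real.exp_mul]
        congr 3; ring
    _ = (∑' j : ℕ, ENNReal.ofReal (C' ^ α * Real.exp (-(a * α) * j))) * J := ENNReal.tsum_mul_right
    _ < ∞ := ENNReal.mul_lt_top (tsum_ofReal_exp_neg_lt_top (by positivity)) hJ

end Measure
end KernelData
namespace KernelData

variable {V W : Type*} [NormedAddCommGroup V] [NormedSpace ℝ V] [FiniteDimensional ℝ V]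
  [NormedAddCommGroup W] [NormedSpace ℝ W] [FiniteDimensional ℝ W]
  {E : V →L[ℝ] V} {D : W →L[ℝ] W} {β : ℝ} {τ φ : V → ℝ}

theorem exists_norm_powKernel_sub_le (h : KernelData E D β τ φ) (c : ℝ) :
    ∃ ε > 0, ∃ C > 0, ∀ y ∈ shell E, ∀ z, τ z ≤ ε →
      ‖powKernel D c φ (z + y) - powKernel D c φ y‖ ≤ C * τ z ^ β := by
  have hβ := h.pos_exponent
  have hlog : ContinuousOn (fun y => |Real.log (φ y)|) (shell E) :=
    ((h.continuousOn fun y hy => ne_zero_of_mem_shell hy).log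
      fun y hy => (h.pos y (ne_zero_of_mem_shell hy)).ne').abs
  obtain ⟨M, hM⟩ := (isCompact_shell E).bddAbove_image hlog
  have hφ : ∀ y ∈ shell E, Real.exp (-M) ≤ φ y ∧ φ y ≤ Real.exp M := by
    intro y hy
    have h1 : |Real.log (φ y)| ≤ M := hM ⟨y, hy, rfl⟩
    have h2 := h.pos y (ne_zero_of_mem_shell hy)
    rw [abs_le] at h1
    exact ⟨(Real.le_log_iff_exp_le h2).1 h1.1, (Real.log_le_iff_le_exp h2).1 h1.2⟩
  set p := Real.exp (-M) / 2 with hp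
  have hp0 : 0 < p := by positivity
  have hnorm : (‖expFlow E 1‖ + 1)⁻¹ ≤ 1 := inv_le_one_of_one_le₀ (by linarith [norm_nonneg (expFlow E 1)])
  obtain ⟨C₁, hC₁, hb₁⟩ := h.adm (‖expFlow E 1‖ + 1)⁻¹ 2 (by positivity) (by linarith)
  obtain ⟨C₂, hC₂, hb₂⟩ := exists_norm_expFlow_log_sub_le (P := Real.exp M + p)
    (D - c • ContinuousLinearMap.id ℝ W) hp0
  refine ⟨min 1 ((p / C₁) ^ β⁻¹), by positivity, C₂ * C₁, by positivity, fun y hy z hz => ?_⟩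
  have hτ := h.radial_nonneg z
  have h3 := hb₁ z y hy.1 (hy.2.trans one_le_two) (hz.trans (min_le_left _ _))
  have h4 : C₁ * τ z ^ β ≤ p := by
    have : τ z ^ β ≤ ((p / C₁) ^ β⁻¹) ^ β :=
      Real.rpow_le_rpow hτ (hz.trans (min_le_right _ _)) hβ.le
    rw [← Real.rpow_mul (by positivity), inv_mul_cancel₀ hβ.ne', Real.rpow_one,
      le_div_iff₀ hC₁] at this
    linarith
  have h5 := abs_le.1 (h3.trans h4)
  have h6 := hφ y hy
  have h7 : Real.exp (-M) = 2 * p := by rw [hp]; ring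
  refine (hb₂ (φ (z + y)) ⟨by linarith, by linarith⟩ (φ y) ⟨by linarith, by linarith⟩).trans ?_
  rw [mul_assoc]
  gcongr

section Measure

variable [MeasurableSpace V] [BorelSpace V] (μ : Measure V) [μ.IsAddHaarMeasure] {α : ℝ}

/-- The `α`-th power of the `L^α` distance between the power kernel and its translate. -/
def _root_.OSS.translationCost (μ : Measure V) (α : ℝ) (E : V →L[ℝ] V) (D : W →L[ℝ] W)
    (φ : V → ℝ) (x : V) : ℝ≥0∞ :=
  ∫⁻ y, ‖powKernel D (homDim E / α) φ (x + y) - powKernel D (homDim E / α) φ y‖ₑ ^ α ∂μ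

theorem translationCost_expFlow_le [Nontrivial V] (h : KernelData E D β τ φ) (hα : 0 < α) (t : ℝ)
    (x : V) :
    translationCost μ α E D φ (expFlow E t x) ≤
      ‖expFlow D t‖ₑ ^ α * translationCost μ α E D φ x := by
  have hP := h.measurable_powKernel (homDim E / α)
  have hm : Measurable fun y => ‖powKernel D (homDim E / α) φ (x + y) -
      powKernel D (homDim E / α) φ y‖ₑ ^ α :=
    (((hP.comp (measurable_const_add x)).sub hP).enorm).pow_const α
  rw [translationCost, lintegral_expFlow μ E t, ← jacobian_mul_enorm_rpow hα D (homDim E) t,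
    mul_assoc, translationCost]
  gcongr
  rw [← lintegral_const_mul _ hm]
  have h1 : ∀ᵐ y ∂μ, y ≠ 0 := by simp [ae_iff]
  have h2 : ∀ᵐ y ∂μ, y ≠ -x := by simp [ae_iff]
  refine lintegral_mono_ae ?_
  filter_upwards [h1, h2] with y hy hy'
  have hxy : x + y ≠ 0 := fun h0 => hy' (eq_neg_of_add_eq_zero_right h0)
  rw [← map_add, h.powKernel_expFlow _ t hy, h.powKernel_expFlow _ t hxy, ← mul_sub]
  exact enorm_mul_rpow_le hα _ _

theorem exists_setLIntegral_shell_le (h : KernelData E D β τ φ) (hα : 0 < α) :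
    ∃ k₀ : ℕ, ∃ C ≥ 0, ∃ b > 0, ∀ x, ‖x‖ ≤ 1 → ∀ k : ℕ, k₀ ≤ k →
      ∫⁻ y in expFlow E k '' shell E,
        ‖powKernel D (homDim E / α) φ (x + y) - powKernel D (homDim E / α) φ y‖ₑ ^ α ∂μ ≤
      ENNReal.ofReal (C * Real.exp (-b * k)) * μ (shell E) := by
  obtain ⟨ε, hε, C₁, hC₁, hb₁⟩ := h.exists_norm_powKernel_sub_le (homDim E / α)
  obtain ⟨T, hT, hτT⟩ := h.radial_bounded
  obtain ⟨c, hc, C₂, hC₂, hb₂⟩ := h.growth_right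
  have h1 := (tendsto_expFlow_neg_apply h.contract_left).eventually_lt_const
    (show 0 < (‖expFlow E 1‖ + 1)⁻¹ by positivity)
  have h2 : ∀ᶠ s : ℝ in atTop, Real.exp (-s) * T ≤ ε := by
    have : Tendsto (fun s : ℝ => Real.exp (-s) * T) atTop (𝓝 (0 * T)) :=
      (Real.tendsto_exp_neg_atTop_nhds_zero).mul_const T
    rw [zero_mul] at this
    exact this.eventually_le_const hε
  obtain ⟨N, hN⟩ := eventually_atTop.1 (h1.and h2)
  refine ⟨⌈N⌉₊, C₂ ^ α * (C₁ * T ^ β) ^ α, by positivity,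
    (β - c) * α, mul_pos (by linarith) hα,
    fun x hx k hk => ?_⟩
  have hk' : N ≤ k := (Nat.le_ceil N).trans (by exact_mod_cast hk)
  obtain ⟨hE, hexp⟩ := hN _ hk'
  have hm := (isCompact_shell E).measurableSet
  set z := expFlow E (-(k : ℝ)) x with hz
  have hzx : expFlow E k z = x := expFlow_apply_neg_self E k x
  have hzn : ‖z‖ < (‖expFlow E 1‖ + 1)⁻¹ :=
    ((expFlow E (-(k : ℝ))).le_opNorm x).trans_lt
      ((mul_le_of_le_one_right (norm_nonneg _) hx).trans_lt hE)
  have hτz : τ z ≤ Real.exp (-(k : ℝ)) * T := by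
    rw [hz, h.radial_expFlow]; gcongr; exact hτT x hx
  have hpoint : ∀ y ∈ shell E,
      ‖powKernel D (homDim E / α) φ (x + expFlow E k y) -
        powKernel D (homDim E / α) φ (expFlow E k y)‖ₑ ^ α ≤
      ‖expFlow (D - (homDim E / α) • ContinuousLinearMap.id ℝ W) k‖ₑ ^ α *
        ENNReal.ofReal ((C₁ * T ^ β) ^ α * Real.exp (-(β * α) * k)) := by
    intro y hy
    have hzy : z + y ≠ 0 := by
      intro h0
      have : ‖y‖ = ‖z‖ := by rw [eq_neg_of_add_eq_zero_right h0, norm_neg]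
      linarith [hy.1]
    conv_lhs => rw [← hzx, ← map_add, h.powKernel_expFlow _ _ hzy,
      h.powKernel_expFlow _ _ (ne_zero_of_mem_shell hy), ← mul_sub]
    refine (enorm_mul_rpow_le hα _ _).trans ?_
    gcongr
    have h3 := hb₁ y hy z (hτz.trans hexp)
    have h4 : C₁ * τ z ^ β ≤ C₁ * T ^ β * Real.exp (-β * k) := by
      have : τ z ^ β ≤ (Real.exp (-(k : ℝ)) * T) ^ β :=
        Real.rpow_le_rpow (h.radial_nonneg z) hτz h.pos_exponent.le
      rw [Real.mul_rpow (Real.exp_pos _).le hT.le, ← Real.exp_mul] at this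
      calc C₁ * τ z ^ β ≤ C₁ * (Real.exp (-(k : ℝ) * β) * T ^ β) := by gcongr
        _ = _ := by rw [show -(k : ℝ) * β = -β * k by ring]; ring
    refine (enorm_rpow_le_ofReal hα (h3.trans h4)).trans_eq ?_
    rw [Real.mul_rpow (by positivity) (Real.exp_pos _).le, ← Real.exp_mul]
    congr 3; ring
  rw [setLIntegral_image_expFlow μ E k hm]
  calc _ ≤ ENNReal.ofReal (Real.exp (k * homDim E)) * ∫⁻ y in shell E,
        ‖expFlow (D - (homDim E / α) • ContinuousLinearMap.id ℝ W) k‖ₑ ^ α *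
        ENNReal.ofReal ((C₁ * T ^ β) ^ α * Real.exp (-(β * α) * k)) ∂μ := by
        exact mul_le_mul_right (setLIntegral_mono' hm hpoint) _
    _ = ‖expFlow D k‖ₑ ^ α * ENNReal.ofReal ((C₁ * T ^ β) ^ α * Real.exp (-(β * α) * k)) *
        μ (shell E) := by
        rw [setLIntegral_const, ← jacobian_mul_enorm_rpow hα D (homDim E) k]
        ring
    _ ≤ ENNReal.ofReal ((C₂ * Real.exp (c * k)) ^ α) *
        ENNReal.ofReal ((C₁ * T ^ β) ^ α * Real.exp (-(β * α) * k)) * μ (shell E) := by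
        gcongr
        exact enorm_rpow_le_ofReal hα (hb₂ k (by positivity))
    _ = _ := by
        rw [← ENNReal.ofReal_mul (by positivity), Real.mul_rpow hC₂.le (Real.exp_pos _).le,
          ← Real.exp_mul]
        congr 2
        have : Real.exp (-((β - c) * α) * k) =
            Real.exp (c * k * α) * Real.exp (-(β * α) * k) := by
          rw [← Real.exp_add]; congr 1; ring
        rw [this]; ring

theorem exists_translationCost_le [Nontrivial V] (h : KernelData E D β τ φ) (hα : 0 < α) :
    ∃ C < ∞, ∀ x, ‖x‖ ≤ 1 → translationCost μ α E D φ x ≤ C := by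
  obtain ⟨k₀, C, hC, b, hb, hfar⟩ := h.exists_setLIntegral_shell_le μ hα
  obtain ⟨a, ha, C₁, hC₁, hb₁⟩ := h.contract_left
  set R := ‖expFlow E k₀‖ * C₁
  set G : V → ℝ≥0∞ := fun y => ‖powKernel D (homDim E / α) φ y‖ₑ ^ α with hG
  have hGm : Measurable G := (h.measurable_powKernel _).enorm.pow_const α
  have hGx : ∀ x, Measurable fun y => G (x + y) := fun x => hGm.comp (measurable_const_add x)
  have hcover : (Set.univ : Set V) ⊆
      Metric.closedBall 0 R ∪ ⋃ j : ℕ, expFlow E ((k₀ + j : ℕ) : ℝ) '' shell E := by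
    intro y _
    by_cases hy0 : y = 0
    · left; rw [hy0]; exact Metric.mem_closedBall_self (by positivity)
    obtain ⟨k, hk⟩ := exists_expFlow_mem_shell h.contract_left hy0
    rcases le_or_gt (k₀ : ℤ) k with hle | hlt
    · right
      refine Set.mem_iUnion.2 ⟨(k - k₀).toNat, _, hk, ?_⟩
      have : (((k₀ + (k - k₀).toNat : ℕ)) : ℝ) = k := by
        have : ((k₀ + (k - k₀).toNat : ℕ) : ℤ) = k := by omega
        exact_mod_cast this
      rw [this, expFlow_apply_neg_self]
    · left
      have hlt' : (k : ℝ) ≤ k₀ := by exact_mod_cast hlt.le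
      rw [mem_closedBall_zero_iff]
      have hy : y = expFlow E k₀ (expFlow E (-((k₀ : ℝ) - k)) (expFlow E (-(k : ℝ)) y)) := by
        rw [← expFlow_add_apply, ← expFlow_add_apply]
        have : (k₀ : ℝ) + -((k₀ : ℝ) - k) + -(k : ℝ) = 0 := by ring
        rw [this, expFlow_zero]; rfl
      have h1 : ‖expFlow E (-((k₀ : ℝ) - k))‖ ≤ C₁ := by
        refine (hb₁ _ (by linarith)).trans (mul_le_of_le_one_right hC₁.le ?_)
        rw [Real.exp_le_one_iff]; nlinarith
      rw [hy]
      refine (ContinuousLinearMap.le_opNorm _ _).trans (mul_le_mul_of_nonneg_left ?_ (norm_nonneg _))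
      refine (ContinuousLinearMap.le_opNorm _ _).trans ?_
      calc _ ≤ C₁ * 1 := by gcongr; exact hk.2
        _ = C₁ := mul_one _
  set J := ∫⁻ y in Metric.closedBall 0 (R + 1), G y ∂μ with hJ
  have hJlt : J < ∞ := h.setLIntegral_closedBall_lt_top μ hα (R + 1)
  have hSlt : μ (shell E) < ∞ := (isCompact_shell E).measure_lt_top
  refine ⟨2 ^ α * (J + J) + (∑' j : ℕ, ENNReal.ofReal (C * Real.exp (-b * j))) * μ (shell E),
    ENNReal.add_lt_top.2 ⟨ENNReal.mul_lt_top (ENNReal.rpow_lt_top_of_nonneg hα.le (by simp))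
      (ENNReal.add_lt_top.2 ⟨hJlt, hJlt⟩),
      ENNReal.mul_lt_top (tsum_ofReal_exp_neg_lt_top hb) hSlt⟩, fun x hx => ?_⟩
  have hnear : ∫⁻ y in Metric.closedBall 0 R,
      ‖powKernel D (homDim E / α) φ (x + y) - powKernel D (homDim E / α) φ y‖ₑ ^ α ∂μ ≤
      2 ^ α * (J + J) := by
    calc _ ≤ ∫⁻ y in Metric.closedBall 0 R, 2 ^ α * (G (x + y) + G y) ∂μ :=
          lintegral_mono fun y => enorm_sub_rpow_le hα _ _
      _ = 2 ^ α * (∫⁻ y in Metric.closedBall 0 R, G (x + y) ∂μ +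
          ∫⁻ y in Metric.closedBall 0 R, G y ∂μ) := by
          rw [← lintegral_add_left (hGx x)]
          exact lintegral_const_mul _ ((hGx x).add hGm)
      _ ≤ 2 ^ α * (J + J) := by
          gcongr
          · rw [hJ, ← lintegral_indicator measurableSet_closedBall,
              ← lintegral_indicator measurableSet_closedBall,
              ← lintegral_add_left_eq_self (μ := μ)
                ((Metric.closedBall 0 (R + 1)).indicator G) x]
            refine lintegral_mono fun y => ?_
            by_cases hy : y ∈ Metric.closedBall 0 R
            · have : x + y ∈ Metric.closedBall 0 (R + 1) := by
                rw [mem_closedBall_zero_iff] at hy ⊢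
                linarith [norm_add_le x y]
              rw [Set.indicator_of_mem hy, Set.indicator_of_mem this]
            · simp [Set.indicator_of_notMem hy]
          · exact lintegral_mono_set (Metric.closedBall_subset_closedBall (by linarith))
  calc translationCost μ α E D φ x
      = ∫⁻ y in Set.univ, ‖powKernel D (homDim E / α) φ (x + y) -
          powKernel D (homDim E / α) φ y‖ₑ ^ α ∂μ := by rw [Measure.restrict_univ]; rfl
    _ ≤ _ := lintegral_mono_set hcover
    _ ≤ _ := lintegral_union_le _ _ _
    _ ≤ _ := by
      gcongr
      refine (lintegral_iUnion_le _ _).trans ?_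
      rw [← ENNReal.tsum_mul_right]
      refine ENNReal.tsum_le_tsum fun j => (hfar x hx (k₀ + j) (by omega)).trans ?_
      have hexp : Real.exp (-b * ((k₀ + j : ℕ) : ℝ)) ≤ Real.exp (-b * j) := by
        rw [Real.exp_le_exp, Nat.cast_add]
        nlinarith [(k₀.cast_nonneg : (0 : ℝ) ≤ k₀), (j.cast_nonneg : (0 : ℝ) ≤ j)]
      gcongr

theorem translationCost_lt_top [Nontrivial V] (h : KernelData E D β τ φ) (hα : 0 < α) (x : V) :
    translationCost μ α E D φ x < ∞ := by
  obtain ⟨C, hC, hb⟩ := h.exists_translationCost_le μ hα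
  have h1 : Tendsto (fun s => ‖expFlow E (-s)‖ * ‖x‖) atTop (𝓝 (0 * ‖x‖)) :=
    (tendsto_expFlow_neg_apply h.contract_left).mul_const _
  rw [zero_mul] at h1
  obtain ⟨s, hs⟩ := (h1.eventually_le_const one_pos).exists
  have h2 := h.translationCost_expFlow_le μ hα s (expFlow E (-s) x)
  rw [expFlow_apply_neg_self] at h2
  refine h2.trans_lt (ENNReal.mul_lt_top (ENNReal.rpow_lt_top_of_nonneg hα.le enorm_ne_top) ?_)
  exact (hb _ (((expFlow E (-s)).le_opNorm x).trans hs)).trans_lt hC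

theorem tendsto_translationCost [Nontrivial V] (h : KernelData E D β τ φ) (hα : 0 < α) :
    Tendsto (translationCost μ α E D φ) (𝓝 0) (𝓝 0) := by
  obtain ⟨C, hC, hb⟩ := h.exists_translationCost_le μ hα
  have h1 : Tendsto (fun s => ‖expFlow D (-s)‖ₑ ^ α * C) atTop (𝓝 0) := by
    have h2 : Tendsto (fun s => ‖expFlow D (-s)‖ₑ) atTop (𝓝 0) := by
      have := ENNReal.tendsto_ofReal (tendsto_expFlow_neg_apply h.contract_right)
      simpa [ofReal_norm] using this
    have h3 := ((ENNReal.continuous_rpow_const (y := α)).tendsto 0).comp h2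
    rw [ENNReal.zero_rpow_of_pos hα] at h3
    have := ENNReal.Tendsto.mul_const h3 (b := C) (Or.inr hC.ne)
    simpa using this
  rw [ENNReal.tendsto_nhds_zero]
  intro ε hε
  obtain ⟨s, hs⟩ := (h1.eventually_le_const hε).exists
  have hcont : Tendsto (fun x => ‖expFlow E s x‖) (𝓝 0) (𝓝 0) := by
    have := ((expFlow E s).continuous.norm).tendsto 0
    simpa using this
  filter_upwards [hcont.eventually_le_const one_pos] with x hx
  have h2 := h.translationCost_expFlow_le μ hα (-s) (expFlow E s x)
  rw [expFlow_neg_apply_self] at h2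
  refine h2.trans (le_trans ?_ hs)
  gcongr
  exact hb _ hx

end Measure
end KernelData

theorem opPow_eq_expFlow {n : ℕ} (r : ℝ) (A : Op n) : opPow r A = expFlow A (Real.log r) := rfl

theorem exists_polarNorm_le {d : ℕ} {E : Op d}
    (hE : ∃ a > 0, ∃ C : ℝ, 0 < C ∧ ∀ s : ℝ, 0 ≤ s → ‖expFlow E (-s)‖ ≤ C * Real.exp (-a * s)) :
    ∃ C : ℝ, 0 < C ∧ ∀ x, polarNorm E x ≤ C * ‖x‖ := by
  obtain ⟨a, ha, C, hC, hb⟩ := hE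
  refine ⟨C / a, by positivity, fun x => ?_⟩
  have hg : IntervalIntegrable (fun t : ℝ => C * ‖x‖ * t ^ (a - 1)) volume 0 1 :=
    (intervalIntegral.intervalIntegrable_rpow' (by linarith)).const_mul _
  have hle : ∀ t ∈ Set.Ioc (0 : ℝ) 1, ‖‖opPow t E x‖ / t‖ ≤ C * ‖x‖ * t ^ (a - 1) := by
    intro t ht
    rw [Real.norm_eq_abs, abs_of_nonneg (div_nonneg (norm_nonneg _) ht.1.le),
      Real.rpow_sub_one ht.1.ne', ← mul_div_assoc]
    refine div_le_div_of_nonneg_right ?_ ht.1.le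
    have h1 := hb (-Real.log t) (by linarith [Real.log_nonpos ht.1.le ht.2])
    rw [neg_neg] at h1
    have h2 : Real.exp (-a * -Real.log t) = t ^ a := by
      rw [Real.rpow_def_of_pos ht.1]; congr 1; ring
    rw [h2] at h1
    calc ‖opPow t E x‖ ≤ ‖expFlow E (Real.log t)‖ * ‖x‖ := (expFlow E (Real.log t)).le_opNorm x
      _ ≤ C * t ^ a * ‖x‖ := by gcongr
      _ = _ := by ring
  have h := intervalIntegral.norm_integral_le_of_norm_le zero_le_one
    (Eventually.of_forall hle) hg
  rw [intervalIntegral.integral_const_mul, integral_rpow (Or.inl (by linarith))] at h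
  refine (Real.le_norm_self _).trans (h.trans_eq ?_)
  rw [sub_add_cancel, Real.one_rpow, Real.zero_rpow ha.ne']
  ring

theorem radialPart_nonneg {d : ℕ} (E : Op d) (x : Rn d) : 0 ≤ radialPart E x :=
  Real.sInf_nonneg fun _ hr => hr.1.le

theorem radialPart_expFlow {d : ℕ} (E : Op d) (t : ℝ) (x : Rn d) :
    radialPart E (expFlow E t x) = Real.exp t * radialPart E x := by
  have hkey : ∀ r : ℝ, 0 < r →
      opPow (Real.exp t * r) (-E) (expFlow E t x) = opPow r (-E) x := by
    intro r hr
    rw [opPow_eq_expFlow, opPow_eq_expFlow, expFlow_neg_left, expFlow_neg_left,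
      ← expFlow_add_apply, Real.log_mul (Real.exp_pos t).ne' hr.ne', Real.log_exp]
    congr 2; ring
  rw [radialPart, radialPart, ← smul_eq_mul, ← Real.sInf_smul_of_nonneg (Real.exp_pos t).le]
  congr 1
  ext r
  rw [Set.mem_smul_set]
  constructor
  · rintro ⟨hr, hr'⟩
    have hr2 : 0 < Real.exp (-t) * r := mul_pos (Real.exp_pos _) hr
    have hr3 : Real.exp t * (Real.exp (-t) * r) = r := by
      rw [← mul_assoc, ← Real.exp_add, add_neg_cancel, Real.exp_zero, one_mul]
    refine ⟨Real.exp (-t) * r, ⟨hr2, ?_⟩, hr3⟩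
    rwa [← hkey _ hr2, hr3]
  · rintro ⟨s, ⟨hs, hs'⟩, rfl⟩
    rw [smul_eq_mul]
    exact ⟨mul_pos (Real.exp_pos _) hs, by rwa [hkey s hs]⟩

theorem exists_radialPart_le {d : ℕ} {E : Op d}
    (hE : ∃ a > 0, ∃ C : ℝ, 0 < C ∧ ∀ s : ℝ, 0 ≤ s → ‖expFlow E (-s)‖ ≤ C * Real.exp (-a * s)) :
    ∃ T : ℝ, 0 < T ∧ ∀ x : Rn d, ‖x‖ ≤ 1 → radialPart E x ≤ T := by
  obtain ⟨C, hC, hb⟩ := exists_polarNorm_le hE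
  obtain ⟨s, hs⟩ := ((tendsto_expFlow_neg_apply hE).eventually_le_const
    (inv_pos.2 hC)).exists
  refine ⟨Real.exp s, Real.exp_pos s, fun x hx => ?_⟩
  refine csInf_le ⟨0, fun r hr => hr.1.le⟩ ⟨Real.exp_pos s, (hb _).trans ?_⟩
  rw [opPow_eq_expFlow, Real.log_exp, expFlow_neg_left]
  have h1 : ‖expFlow E (-s) x‖ ≤ C⁻¹ :=
    ((expFlow E (-s)).le_opNorm x).trans
      ((mul_le_of_le_one_right (norm_nonneg _) hx).trans hs)
  calc C * ‖expFlow E (-s) x‖ ≤ C * C⁻¹ := by gcongr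
    _ = 1 := mul_inv_cancel₀ hC.ne'

theorem kernelData_of_isAdmissible {d m : ℕ} (hd : 0 < d) (hm : 0 < m) {E : Op d} (hE : E ∈ Q d)
    {D : Op m} (hD : D ∈ Q m) {β : ℝ} (hβ : 0 < β) {φ : Rn d → ℝ} (hφ : IsHomogeneous E φ)
    (hφ' : IsAdmissible β E φ) {H : ℝ} (hH : IsGreatest (reEigenvalues D) H) (hHβ : H < β) :
    KernelData E D β (radialPart E) φ where
  contract_left := exists_norm_expFlow_neg_le hd hE
  contract_right := exists_norm_expFlow_neg_le hm hD
  growth_right := exists_norm_expFlow_le hm D β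
    fun z hz => (hH.2 ⟨z, hz, rfl⟩).trans_lt hHβ
  pos_exponent := hβ
  radial_nonneg := radialPart_nonneg E
  radial_expFlow := radialPart_expFlow E
  radial_bounded := exists_radialPart_le (exists_norm_expFlow_neg_le hd hE)
  pos := hφ'.2.1
  hom := fun t x hx => by
    have := hφ (Real.exp t) (Real.exp_pos t) x hx
    rwa [opPow_eq_expFlow, Real.log_exp] at this
  adm := hφ'.2.2

section MovingAverageKernel

variable {d m : ℕ} {α : ℝ} {E : Op d} {D : Op m} {β : ℝ} {τ φ : Rn d → ℝ}

theorem maKernel_eq (α : ℝ) (E : Op d) (D : Op m) (φ : Rn d → ℝ) (x y : Rn d) :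
    maKernel α E D φ x y =
      powKernel D (homDim E / α) φ (x - y) - powKernel D (homDim E / α) φ (-y) := rfl

theorem measurable_maKernel (h : KernelData E D β τ φ) (x : Rn d) :
    Measurable (maKernel α E D φ x) := by
  have hP := h.measurable_powKernel (homDim E / α)
  exact (hP.comp (measurable_const_sub x)).sub (hP.comp measurable_neg)

theorem intNormPow_maKernel (α : ℝ) (E : Op d) (D : Op m) (φ : Rn d → ℝ) (x : Rn d) :
    intNormPow α (maKernel α E D φ x) = translationCost volume α E D φ x := by
  rw [intNormPow, translationCost, ← lintegral_neg_eq_self]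
  refine lintegral_congr fun y => ?_
  rw [maKernel_eq, sub_neg_eq_add, neg_neg]

theorem maKernel_sub (α : ℝ) (E : Op d) (D : Op m) (φ : Rn d → ℝ) (x x₀ y : Rn d) :
    maKernel α E D φ x y - maKernel α E D φ x₀ y = maKernel α E D φ (x - x₀) (y - x₀) := by
  rw [maKernel_eq, maKernel_eq, maKernel_eq, sub_sub_sub_cancel_right, sub_sub_sub_cancel_right,
    neg_sub]

theorem intNormPow_maKernel_sub (α : ℝ) (E : Op d) (D : Op m) (φ : Rn d → ℝ) (x x₀ : Rn d) :
    intNormPow α (fun y => maKernel α E D φ x y - maKernel α E D φ x₀ y) =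
      translationCost volume α E D φ (x - x₀) := by
  rw [← intNormPow_maKernel, intNormPow, intNormPow]
  simp_rw [maKernel_sub]
  exact lintegral_sub_right_eq_self (fun y => ‖maKernel α E D φ (x - x₀) y‖ₑ ^ α) x₀

theorem maKernel_expFlow (h : KernelData E D β τ φ) (t : ℝ) {x y : Rn d} (hy : y ≠ 0)
    (hxy : x ≠ y) :
    maKernel α E D φ (expFlow E t x) (expFlow E t y) =
      expFlow (D - (homDim E / α) • ContinuousLinearMap.id ℝ (Rn m)) t *
        maKernel α E D φ x y := by
  rw [maKernel_eq, maKernel_eq, ← map_sub, ← map_neg, h.powKernel_expFlow _ _ (sub_ne_zero.2 hxy),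
    h.powKernel_expFlow _ _ (neg_ne_zero.2 hy), mul_sub]

end MovingAverageKernel

/-! ### Convergence in measure -/

section InMeasure

variable {Ω : Type*} [MeasurableSpace Ω] {P : Measure Ω} {ι : Type*} {l : Filter ι}
  {G G' : Type*} [NormedAddCommGroup G] [NormedAddCommGroup G']

theorem tendstoInMeasure_add {f f' : ι → Ω → G} {g g' : Ω → G}
    (h : TendstoInMeasure P f l g) (h' : TendstoInMeasure P f' l g') :
    TendstoInMeasure P (fun i ω => f i ω + f' i ω) l (fun ω => g ω + g' ω) := by
  rw [tendstoInMeasure_iff_norm] at h h' ⊢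
  intro ε hε
  have h1 := (h (ε / 2) (by positivity)).add (h' (ε / 2) (by positivity))
  rw [add_zero] at h1
  refine tendsto_of_tendsto_of_tendsto_of_le_of_le tendsto_const_nhds h1 (fun _ => zero_le)
    fun i => (measure_mono ?_).trans (measure_union_le _ _)
  intro ω hω
  by_contra hcon
  simp only [Set.mem_union, Set.mem_ofPred_eq, not_or, not_le] at hcon hω
  have : ‖f i ω + f' i ω - (g ω + g' ω)‖ ≤ ‖f i ω - g ω‖ + ‖f' i ω - g' ω‖ := by
    rw [add_sub_add_comm]; exact norm_add_le _ _
  linarith [hcon.1, hcon.2]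

theorem tendstoInMeasure_of_lipschitz {f : ι → Ω → G} {g : Ω → G} {φ : G → G'} {K : ℝ}
    (hφ : ∀ x y, ‖φ x - φ y‖ ≤ K * ‖x - y‖) (h : TendstoInMeasure P f l g) :
    TendstoInMeasure P (fun i ω => φ (f i ω)) l (fun ω => φ (g ω)) := by
  rw [tendstoInMeasure_iff_norm] at h ⊢
  intro ε hε
  refine tendsto_of_tendsto_of_tendsto_of_le_of_le tendsto_const_nhds
    (h (ε / (|K| + 1)) (by positivity)) (fun _ => zero_le) fun i => measure_mono ?_
  intro ω hω
  simp only [Set.mem_ofPred_eq] at hω ⊢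
  rw [div_le_iff₀ (by positivity)]
  have h1 := hφ (f i ω) (g ω)
  have h2 : K * ‖f i ω - g ω‖ ≤ (|K| + 1) * ‖f i ω - g ω‖ := by
    gcongr; linarith [le_abs_self K]
  linarith

/-- A sequence that is Cauchy in measure converges in measure. -/
theorem exists_tendstoInMeasure_of_cauchy [IsFiniteMeasure P] [MeasurableSpace G] [BorelSpace G]
    [SecondCountableTopology G] [CompleteSpace G] {f : ℕ → Ω → G} (hf : ∀ n, Measurable (f n))
    (h : ∀ ε > 0, ∀ δ > 0, ∃ N, ∀ n ≥ N, ∀ k ≥ N, P {ω | ε ≤ ‖f n ω - f k ω‖} ≤ δ) :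
    ∃ g : Ω → G, Measurable g ∧ TendstoInMeasure P f atTop g := by
  have hpos : ∀ j : ℕ, (0 : ℝ≥0∞) < ENNReal.ofReal ((1 / 2) ^ j) :=
    fun j => ENNReal.ofReal_pos.2 (by positivity)
  choose N hN using fun j : ℕ => h ((1 / 2) ^ j) (by positivity) _ (hpos j)
  set n : ℕ → ℕ := fun j => j + ∑ i ∈ Finset.range (j + 1), N i with hn
  have hnN : ∀ j, N j ≤ n j := fun j =>
    (Finset.single_le_sum (f := N) (fun _ _ => Nat.zero_le _) (Finset.self_mem_range_succ j)).trans
      (Nat.le_add_left _ _)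
  have hmono : ∀ j, n j ≤ n (j + 1) := fun j => by
    simp only [hn]; rw [Finset.sum_range_succ _ (j + 1)]; omega
  have hae : ∀ᵐ ω ∂P, ∀ᶠ j in atTop, ω ∉ {ω | (1 / 2 : ℝ) ^ j ≤ ‖f (n j) ω - f (n (j + 1)) ω‖} := by
    refine ae_eventually_notMem (ne_top_of_le_ne_top ?_ (ENNReal.tsum_le_tsum fun j =>
      hN j (n j) (hnN j) (n (j + 1)) ((hnN j).trans (hmono j))))
    rw [← ENNReal.ofReal_tsum_of_nonneg (fun j => by positivity) summable_geometric_two]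
    exact ENNReal.ofReal_ne_top
  have hlim : ∀ᵐ ω ∂P, ∃ y, Tendsto (fun j => f (n j) ω) atTop (𝓝 y) := by
    filter_upwards [hae] with ω hω
    obtain ⟨J, hJ⟩ := eventually_atTop.1 hω
    have hc : CauchySeq fun j => f (n (j + J)) ω := by
      refine cauchySeq_of_le_geometric (1 / 2) ((1 / 2) ^ J) (by norm_num) fun j => ?_
      have := hJ (j + J) (by omega)
      simp only [not_le] at this
      rw [dist_eq_norm, ← pow_add, add_comm J j, show j + 1 + J = j + J + 1 by ring]
      exact this.le
    obtain ⟨y, hy⟩ := cauchySeq_tendsto_of_complete hc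
    exact ⟨y, (tendsto_add_atTop_iff_nat (f := fun j => f (n j) ω) J).1 hy⟩
  obtain ⟨g, hg, hgl⟩ := measurable_limit_of_tendsto_metrizable_ae (L := atTop)
    (fun j => (hf (n j)).aemeasurable) hlim
  refine ⟨g, hg, ?_⟩
  have hsub := tendstoInMeasure_of_tendsto_ae (fun j => (hf (n j)).aestronglyMeasurable) hgl
  rw [tendstoInMeasure_iff_norm] at hsub ⊢
  intro ε hε
  rw [ENNReal.tendsto_nhds_zero]
  intro δ hδ
  have hδ2 : 0 < δ / 2 := ENNReal.half_pos hδ.ne'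
  obtain ⟨N₀, hN₀⟩ := h (ε / 2) (by positivity) _ hδ2
  obtain ⟨j, hj, hjN⟩ := (((hsub (ε / 2) (by positivity)).eventually_le_const hδ2).and
    (eventually_ge_atTop N₀)).exists
  have hjn : N₀ ≤ n j := hjN.trans (Nat.le_add_right _ _)
  filter_upwards [eventually_ge_atTop N₀] with k hk
  calc P {ω | ε ≤ ‖f k ω - g ω‖}
      ≤ P ({ω | ε / 2 ≤ ‖f k ω - f (n j) ω‖} ∪ {ω | ε / 2 ≤ ‖f (n j) ω - g ω‖}) := by
        refine measure_mono fun ω hω => ?_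
        by_contra hcon
        simp only [Set.mem_union, Set.mem_ofPred_eq, not_or, not_le] at hcon hω
        linarith [norm_sub_le_norm_sub_add_norm_sub (f k ω) (f (n j) ω) (g ω), hcon.1, hcon.2]
    _ ≤ δ / 2 + δ / 2 := (measure_union_le _ _).trans (add_le_add (hN₀ k hk (n j) hjn) hj)
    _ = δ := ENNReal.add_halves δ

end InMeasure

/-! ### Tail bounds -/

theorem norm_one_sub_cexp_neg_le {c : ℝ} (hc : 0 ≤ c) : ‖1 - Complex.exp (-(c : ℂ))‖ ≤ c := by
  rw [← Complex.ofReal_neg, ← Complex.ofReal_exp, ← Complex.ofReal_one, ← Complex.ofReal_sub,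
    Complex.norm_real, Real.norm_eq_abs, abs_of_nonneg]
  · linarith [Real.add_one_le_exp (-c)]
  · linarith [Real.exp_le_one_iff.2 (neg_nonpos.2 hc)]

theorem measureReal_dual_le {G : Type*} [NormedAddCommGroup G] [NormedSpace ℝ G]
    [MeasurableSpace G] [BorelSpace G] (μ : Measure G) [IsProbabilityMeasure μ] {α b : ℝ}
    (hα : 0 < α) (hb : 0 ≤ b)
    (h : ∀ L : StrongDual ℝ G, ∃ c : ℝ, 0 ≤ c ∧ c ≤ ‖L‖ ^ α * b ∧
      charFunDual μ L = Complex.exp (-(c : ℂ))) {r : ℝ} (hr : 0 < r) (L : StrongDual ℝ G)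
    (hL : ‖L‖ ≤ 1) : μ.real {x | r < |L x|} ≤ 2 * (2 / r) ^ α * b := by
  refine (measureReal_abs_dual_gt_le_integral_charFunDual L hr).trans ?_
  have hbound : ∀ t ∈ Set.uIoc (-2 * r⁻¹) (2 * r⁻¹), ‖1 - charFunDual μ (t • L)‖ ≤ (2 / r) ^ α * b := by
    intro t ht
    obtain ⟨c, hc0, hc, he⟩ := h (t • L)
    rw [he]
    refine (norm_one_sub_cexp_neg_le hc0).trans (hc.trans ?_)
    have h2 : -2 * r⁻¹ ≤ 2 * r⁻¹ := by
      have : 0 < r⁻¹ := by positivity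
      linarith
    rw [Set.uIoc_of_le h2] at ht
    gcongr
    rw [norm_smul, Real.norm_eq_abs, div_eq_mul_inv]
    have h3 : |t| ≤ 2 * r⁻¹ := abs_le.2 ⟨by linarith [ht.1], ht.2⟩
    calc |t| * ‖L‖ ≤ 2 * r⁻¹ * 1 := by gcongr
      _ = _ := mul_one _
  have h1 := intervalIntegral.norm_integral_le_of_norm_le_const hbound
  calc _ ≤ 2⁻¹ * r * ((2 / r) ^ α * b * |2 * r⁻¹ - -2 * r⁻¹|) := by gcongr
    _ = _ := by
      have : 2 * r⁻¹ - -2 * r⁻¹ = 4 * r⁻¹ := by ring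
      rw [this, abs_of_pos (by positivity)]
      field_simp
      ring

theorem exists_measureReal_norm_le (m : ℕ) {α ε : ℝ} (hα : 0 < α) (hε : 0 < ε) :
    ∃ K : ℝ, 0 ≤ K ∧ ∀ (μ : Measure (Rn m)) [IsProbabilityMeasure μ] (b : ℝ), 0 ≤ b →
      (∀ L : StrongDual ℝ (Rn m), ∃ c : ℝ, 0 ≤ c ∧ c ≤ ‖L‖ ^ α * b ∧
        charFunDual μ L = Complex.exp (-(c : ℂ))) → μ.real {x | ε ≤ ‖x‖} ≤ K * b := by
  set r := ε / (m + 1) with hr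
  have hr0 : 0 < r := by positivity
  refine ⟨m * (2 * (2 / r) ^ α), by positivity, fun μ _ b hb h => ?_⟩
  have hsub : {x : Rn m | ε ≤ ‖x‖} ⊆ ⋃ i : Fin m, {x | r < |EuclideanSpace.proj (𝕜 := ℝ) i x|} := by
    intro x hx
    by_contra hcon
    simp only [Set.mem_iUnion, Set.mem_ofPred_eq, not_exists, not_lt] at hcon hx
    have h1 : ‖x‖ ≤ ∑ i : Fin m, r := by
      conv_lhs => rw [← (EuclideanSpace.basisFun (Fin m) ℝ).sum_repr x]
      refine (norm_sum_le _ _).trans (Finset.sum_le_sum fun i _ => ?_)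
      rw [norm_smul]
      simpa using hcon i
    rw [Finset.sum_const, Finset.card_univ, Fintype.card_fin, nsmul_eq_mul, hr] at h1
    have h2 : m * (ε / (m + 1)) < ε := by
      rw [mul_div_assoc', div_lt_iff₀ (by positivity)]
      linarith
    linarith
  have hproj : ∀ i : Fin m, ‖(EuclideanSpace.proj i : StrongDual ℝ (Rn m))‖ ≤ 1 := fun i => by
    refine ContinuousLinearMap.opNorm_le_bound _ zero_le_one fun x => ?_
    rw [one_mul]; exact PiLp.norm_apply_le x i
  calc μ.real {x : Rn m | ε ≤ ‖x‖}
      ≤ μ.real (⋃ i : Fin m, {x | r < |EuclideanSpace.proj (𝕜 := ℝ) i x|}) :=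
        measureReal_mono hsub
    _ ≤ ∑ i : Fin m, μ.real {x | r < |EuclideanSpace.proj (𝕜 := ℝ) i x|} :=
        measureReal_iUnion_fintype_le _
    _ ≤ ∑ i : Fin m, 2 * (2 / r) ^ α * b :=
        Finset.sum_le_sum fun i _ => measureReal_dual_le μ hα hb h hr0 _ (hproj i)
    _ = _ := by simp; ring


instance isFiniteMeasure_unifSphere (α : ℝ) (m : ℕ) : IsFiniteMeasure (unifSphere α m) := by
  constructor
  rw [unifSphere, Measure.smul_apply, smul_eq_mul]
  exact ENNReal.mul_lt_top ENNReal.ofReal_lt_top (measure_lt_top _ _)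

theorem mem_finiteSets_control {α : ℝ} {d m : ℕ} {A : Set (Rn d)} (hA : MeasurableSet A)
    (hA' : volume A < ∞) : A ∈ finiteSets (control α d m) := by
  refine ⟨hA, ?_⟩
  rw [control, Measure.prod_prod]
  exact ENNReal.mul_lt_top hA' (measure_lt_top _ _)

theorem slice_control (α : ℝ) {d m : ℕ} (A : Set (Rn d)) :
    slice (control α d m) A = volume A • unifSphere α m := by
  rw [slice, control, ← Measure.prod_restrict, Measure.restrict_univ, Measure.snd,
    Measure.map_snd_prod, Measure.restrict_apply_univ]

namespace IsSaSRandomMeasure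

variable {Ω : Type*} [MeasurableSpace Ω] {P : Measure Ω} {α : ℝ} {d m : ℕ}
  {M : Set (Rn d) → Ω → Rn m}

theorem charFunDual_map (hM : IsSaSRandomMeasure P α (control α d m) M) (hα : 0 < α) (hm : 1 ≤ m)
    {A : Set (Rn d)} (hA : MeasurableSet A) (hA' : volume A < ∞) (L : StrongDual ℝ (Rn m)) :
    charFunDual (P.map (M A)) L =
      Complex.exp (-(((volume A).toReal * ‖L‖ ^ α : ℝ) : ℂ)) := by
  have h := hM.spectral A (mem_finiteSets_control hA hA') ((InnerProductSpace.toDual ℝ (Rn m)).symm L)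
  rw [charFun_toDual_symm_eq_charFunDual, slice_control, integral_smul_measure,
    integral_unifSphere hα hm, LinearIsometryEquiv.norm_map] at h
  exact h

theorem ae_eq_zero_empty (hM : IsSaSRandomMeasure P α (control α d m) M) : M ∅ =ᵐ[P] 0 := by
  have h0 : (∅ : Set (Rn d)) ∈ finiteSets (control α d m) :=
    mem_finiteSets_control MeasurableSet.empty (by simp)
  have h := hM.sigma_additive (fun _ => ∅) (fun _ => h0) (fun _ _ _ => disjoint_bot_left)
    (by simpa using h0)
  filter_upwards [h] with ω hω
  simp only [Finset.sum_const, Finset.card_range, Set.iUnion_empty] at hω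
  have h1 := (hω.comp (tendsto_add_atTop_nat 1)).sub hω
  simp only [Function.comp_apply, add_smul, one_smul, add_sub_cancel_left, sub_self] at h1
  exact tendsto_nhds_unique tendsto_const_nhds h1

theorem ae_eq_union (hM : IsSaSRandomMeasure P α (control α d m) M) {A B : Set (Rn d)}
    (hA : MeasurableSet A) (hA' : volume A < ∞) (hB : MeasurableSet B) (hB' : volume B < ∞)
    (hAB : Disjoint A B) : ∀ᵐ ω ∂P, M (A ∪ B) ω = M A ω + M B ω := by
  set S : ℕ → Set (Rn d) := fun n => if n = 0 then A else if n = 1 then B else ∅ with hS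
  have hS0 : S 0 = A := rfl
  have hS1 : S 1 = B := rfl
  have hS2 : ∀ n, 2 ≤ n → S n = ∅ := fun n hn => by
    simp only [hS]; rw [if_neg (by omega), if_neg (by omega)]
  have hU : ⋃ n, S n = A ∪ B := by
    ext x
    simp only [Set.mem_iUnion, Set.mem_union]
    constructor
    · rintro ⟨n, hn⟩
      rcases n with _ | _ | n
      · exact Or.inl hn
      · exact Or.inr hn
      · rw [hS2 _ (by omega)] at hn; exact hn.elim
    · rintro (h | h)
      · exact ⟨0, h⟩
      · exact ⟨1, h⟩
  have hfin : ∀ n, S n ∈ finiteSets (control α d m) := fun n => by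
    rcases n with _ | _ | n
    · exact mem_finiteSets_control hA hA'
    · exact mem_finiteSets_control hB hB'
    · rw [hS2 _ (by omega)]
      exact mem_finiteSets_control MeasurableSet.empty (by simp)
  have hdis : Pairwise fun i j => Disjoint (S i) (S j) := by
    intro i j hij
    rcases i with _ | _ | i <;> rcases j with _ | _ | j
    · exact absurd rfl hij
    · exact hAB
    · rw [hS2 (j + 1 + 1) (by omega)]; exact disjoint_bot_right
    · exact hAB.symm
    · exact absurd rfl hij
    · rw [hS2 (j + 1 + 1) (by omega)]; exact disjoint_bot_right
    · rw [hS2 (i + 1 + 1) (by omega)]; exact disjoint_bot_left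
    · rw [hS2 (i + 1 + 1) (by omega)]; exact disjoint_bot_left
    · rw [hS2 (i + 1 + 1) (by omega)]; exact disjoint_bot_left
  have h := hM.sigma_additive S hfin hdis (by
    rw [hU]
    exact mem_finiteSets_control (hA.union hB) (measure_union_lt_top hA' hB'))
  rw [hU] at h
  filter_upwards [h, hM.ae_eq_zero_empty] with ω hω h0
  refine tendsto_nhds_unique hω (tendsto_const_nhds.congr' ?_)
  filter_upwards [eventually_ge_atTop 2] with n hn
  obtain ⟨k, rfl⟩ := Nat.exists_eq_add_of_le' hn
  rw [Finset.sum_range_succ', Finset.sum_range_succ', Finset.sum_eq_zero]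
  · rw [zero_add, hS0, show S (0 + 1) = B from rfl, add_comm]
  · intro i _
    rw [hS2 _ (by omega), h0]; rfl

theorem ae_eq_biUnion {γ : Type*} (hM : IsSaSRandomMeasure P α (control α d m) M) (s : Finset γ)
    (A : γ → Set (Rn d)) (hA : ∀ c ∈ s, MeasurableSet (A c)) (hA' : ∀ c ∈ s, volume (A c) < ∞)
    (hdis : ∀ c ∈ s, ∀ c' ∈ s, c ≠ c' → Disjoint (A c) (A c')) :
    ∀ᵐ ω ∂P, M (⋃ c ∈ s, A c) ω = ∑ c ∈ s, M (A c) ω := by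
  classical
  induction s using Finset.induction_on with
  | empty => filter_upwards [hM.ae_eq_zero_empty] with ω hω; simpa using hω
  | insert a s ha ih =>
    have ih' := ih (fun c hc => hA c (Finset.mem_insert_of_mem hc))
      (fun c hc => hA' c (Finset.mem_insert_of_mem hc))
      (fun c hc c' hc' => hdis c (Finset.mem_insert_of_mem hc) c' (Finset.mem_insert_of_mem hc'))
    have hu := hM.ae_eq_union (A := A a) (B := ⋃ c ∈ s, A c) (hA a (Finset.mem_insert_self a s))
      (hA' a (Finset.mem_insert_self a s))
      (s.measurableSet_biUnion fun c hc => hA c (Finset.mem_insert_of_mem hc))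
      (measure_biUnion_lt_top s.finite_toSet fun c hc => hA' c (Finset.mem_insert_of_mem hc))
      (Set.disjoint_iUnion₂_right.2 fun c hc => hdis a (Finset.mem_insert_self a s) c
        (Finset.mem_insert_of_mem hc) (fun h => ha (h ▸ hc)))
    filter_upwards [ih', hu] with ω h1 h2
    rw [Finset.set_biUnion_insert, h2, h1, Finset.sum_insert ha]

theorem iIndepFun_finset {γ : Type*} (hM : IsSaSRandomMeasure P α (control α d m) M)
    (s : Finset γ) (A : γ → Set (Rn d)) (hA : ∀ c ∈ s, MeasurableSet (A c))
    (hA' : ∀ c ∈ s, volume (A c) < ∞)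
    (hdis : ∀ c ∈ s, ∀ c' ∈ s, c ≠ c' → Disjoint (A c) (A c')) :
    iIndepFun (fun c : s => M (A c)) P := by
  have h := hM.indep_scattered s.card (fun i => A (s.equivFin.symm i))
    (fun i => mem_finiteSets_control (hA _ (s.equivFin.symm i).2) (hA' _ (s.equivFin.symm i).2))
    (fun i j hij => hdis _ (s.equivFin.symm i).2 _ (s.equivFin.symm j).2
      fun h => hij (s.equivFin.symm.injective (Subtype.ext h)))
  have h2 := h.precomp s.equivFin.injective
  simpa using h2

theorem measurable_of_finite (hM : IsSaSRandomMeasure P α (control α d m) M) {A : Set (Rn d)}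
    (hA : MeasurableSet A) (hA' : volume A < ∞) : Measurable (M A) :=
  hM.measurable A (mem_finiteSets_control hA hA')

/-- The integral of a simple function may be computed on any finer partition. -/
theorem simpleIntegral_map {γ : Type*} [Zero γ] (hM : IsSaSRandomMeasure P α (control α d m) M)
    (F : SimpleFunc (Rn d) γ) (hF : F.FinMeasSupp volume) (g : γ → Op m) (hg : g 0 = 0) :
    ∀ᵐ ω ∂P, simpleIntegral M (F.map g) ω = ∑ c ∈ F.range, g c (M (F ⁻¹' {c}) ω) := by
  classical
  have hkey : ∀ᵐ ω ∂P, ∀ R ∈ (F.map g).range, R (M ((F.map g) ⁻¹' {R}) ω) =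
      ∑ c ∈ F.range with g c = R, g c (M (F ⁻¹' {c}) ω) := by
    rw [Finset.eventually_all]
    intro R _
    by_cases hR : R = 0
    · refine Eventually.of_forall fun ω => ?_
      rw [hR, zero_apply, Finset.sum_eq_zero]
      intro c hc
      rw [(Finset.mem_filter.1 hc).2, zero_apply]
    · have hc0 : ∀ c ∈ F.range.filter (fun c => g c = R), c ≠ 0 := by
        intro c hc h0
        rw [h0, Finset.mem_filter, hg] at hc
        exact hR hc.2.symm
      have h := hM.ae_eq_biUnion (F.range.filter fun c => g c = R) (fun c => F ⁻¹' {c})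
        (fun c _ => F.measurableSet_fiber c)
        (fun c hc => hF.meas_preimage_singleton_ne_zero (hc0 c hc))
        (fun c _ c' _ hcc' => Disjoint.preimage _ (by simpa using hcc'))
      have hset : (F.map g) ⁻¹' {R} = ⋃ c ∈ F.range.filter (fun c => g c = R), F ⁻¹' {c} := by
        rw [SimpleFunc.map_preimage_singleton]
        ext x; simp
      filter_upwards [h] with ω hω
      rw [hset, hω, map_sum]
      refine Finset.sum_congr rfl fun c hc => ?_
      rw [(Finset.mem_filter.1 hc).2]
  filter_upwards [hkey] with ω hω
  rw [simpleIntegral, Finset.sum_congr rfl hω]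
  refine Finset.sum_fiberwise_of_maps_to (fun c hc => ?_) _
  rw [SimpleFunc.range_map]
  exact Finset.mem_image_of_mem _ hc

theorem simpleIntegral_add (hM : IsSaSRandomMeasure P α (control α d m) M)
    {F G : SimpleFunc (Rn d) (Op m)} (hF : F.FinMeasSupp volume) (hG : G.FinMeasSupp volume) :
    ∀ᵐ ω ∂P, simpleIntegral M (F + G) ω = simpleIntegral M F ω + simpleIntegral M G ω := by
  have hFG := hF.pair hG
  have h1 := hM.simpleIntegral_map (F.pair G) hFG (fun p => p.1 + p.2) (add_zero 0)
  have h2 := hM.simpleIntegral_map (F.pair G) hFG Prod.fst rfl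
  have h3 := hM.simpleIntegral_map (F.pair G) hFG Prod.snd rfl
  filter_upwards [h1, h2, h3] with ω h1 h2 h3
  have e1 : (F.pair G).map (fun p => p.1 + p.2) = F + G := by ext; rfl
  have e2 : (F.pair G).map Prod.fst = F := by ext; rfl
  have e3 : (F.pair G).map Prod.snd = G := by ext; rfl
  rw [e1] at h1
  rw [e2] at h2
  rw [e3] at h3
  rw [h1, h2, h3, ← Finset.sum_add_distrib]
  rfl

theorem simpleIntegral_pair_sub (hM : IsSaSRandomMeasure P α (control α d m) M)
    {F G : SimpleFunc (Rn d) (Op m)} (hF : F.FinMeasSupp volume) (hG : G.FinMeasSupp volume) :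
    ∀ᵐ ω ∂P, simpleIntegral M ((F.pair G).map fun p => p.1 - p.2) ω =
      simpleIntegral M F ω - simpleIntegral M G ω := by
  have hFG := hF.pair hG
  have h1 := hM.simpleIntegral_map (F.pair G) hFG (fun p => p.1 - p.2) (sub_zero 0)
  have h2 := hM.simpleIntegral_map (F.pair G) hFG Prod.fst rfl
  have h3 := hM.simpleIntegral_map (F.pair G) hFG Prod.snd rfl
  filter_upwards [h1, h2, h3] with ω h1 h2 h3
  have e2 : (F.pair G).map Prod.fst = F := by ext; rfl
  have e3 : (F.pair G).map Prod.snd = G := by ext; rfl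
  rw [e2] at h2
  rw [e3] at h3
  rw [h1, h2, h3, ← Finset.sum_sub_distrib]
  rfl

theorem simpleIntegral_map_comp (hM : IsSaSRandomMeasure P α (control α d m) M)
    {F : SimpleFunc (Rn d) (Op m)} (hF : F.FinMeasSupp volume) (R : Op m) :
    ∀ᵐ ω ∂P, simpleIntegral M (F.map (R * ·)) ω = R (simpleIntegral M F ω) := by
  filter_upwards [hM.simpleIntegral_map F hF (R * ·) (mul_zero R)] with ω h
  rw [h, simpleIntegral, map_sum]
  rfl

theorem measurable_simpleIntegral (hM : IsSaSRandomMeasure P α (control α d m) M)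
    {F : SimpleFunc (Rn d) (Op m)} (hF : F.FinMeasSupp volume) :
    Measurable (simpleIntegral M F) := by
  refine Finset.measurable_sum _ fun R _ => ?_
  by_cases hR : R = 0
  · rw [hR]; exact measurable_const
  · exact R.continuous.measurable.comp (hM.measurable_of_finite (F.measurableSet_fiber R)
      (hF.meas_preimage_singleton_ne_zero hR))

end IsSaSRandomMeasure

/-- The exponent `∫ ‖L ∘ F(u)‖^α du` of the characteristic function of `∫ F dM` at `L`. -/
def stableExponent {d m : ℕ} (α : ℝ) (F : Rn d → Op m) (L : StrongDual ℝ (Rn m)) : ℝ≥0∞ :=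
  ∫⁻ u, ‖L.comp (F u)‖ₑ ^ α

theorem stableExponent_le {d m : ℕ} {α : ℝ} (hα : 0 < α) (F : Rn d → Op m)
    (L : StrongDual ℝ (Rn m)) : stableExponent α F L ≤ ‖L‖ₑ ^ α * intNormPow α F := by
  rw [stableExponent, intNormPow, ← lintegral_const_mul' _ _
    (ENNReal.rpow_lt_top_of_nonneg hα.le enorm_ne_top).ne]
  refine lintegral_mono fun u => ?_
  rw [← ENNReal.mul_rpow_of_nonneg _ _ hα.le]
  exact ENNReal.rpow_le_rpow (L.opENorm_comp_le (F u)) hα.le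

theorem IsSaSRandomMeasure.charFunDual_simpleIntegral {Ω : Type*} [MeasurableSpace Ω]
    {P : Measure Ω} [IsProbabilityMeasure P] {α : ℝ} {d m : ℕ}
    {M : Set (Rn d) → Ω → Rn m} (hM : IsSaSRandomMeasure P α (control α d m) M) (hα : 0 < α)
    (hm : 1 ≤ m) {F : SimpleFunc (Rn d) (Op m)} (hF : F.FinMeasSupp volume)
    (L : StrongDual ℝ (Rn m)) :
    charFunDual (P.map (simpleIntegral M F)) L =
      Complex.exp (-((stableExponent α F L).toReal : ℂ)) := by
  classical
  set s := F.range.filter (· ≠ 0) with hs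
  have hs0 : ∀ R ∈ s, R ≠ 0 := fun R hR => (Finset.mem_filter.1 hR).2
  have hfin : ∀ R ∈ s, volume (F ⁻¹' {R}) < ∞ := fun R hR =>
    hF.meas_preimage_singleton_ne_zero (hs0 R hR)
  have hsum : simpleIntegral M F = fun ω => ∑ R ∈ s, R (M (F ⁻¹' {R}) ω) := by
    funext ω
    rw [simpleIntegral, hs, Finset.sum_filter_of_ne]
    rintro R _ h rfl
    exact h rfl
  have hmeas : ∀ R ∈ s, Measurable (M (F ⁻¹' {R})) := fun R hR =>
    hM.measurable_of_finite (F.measurableSet_fiber R) (hfin R hR)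
  have hind := hM.iIndepFun_finset s (fun R => F ⁻¹' {R}) (fun R _ => F.measurableSet_fiber R) hfin
    (fun c _ c' _ hcc' => Disjoint.preimage _ (by simpa using hcc'))
  have hind2 : iIndepFun (s.restrict fun R ω => R (M (F ⁻¹' {R}) ω)) P :=
    hind.comp (fun R x => (R : Op m) x) (fun R => (R : Op m).continuous.measurable)
  rw [hsum, hind2.charFunDual_map_fun_finsetSum_eq_prod
    (fun R hR => (R.continuous.measurable.comp (hmeas R hR)).aemeasurable), Finset.prod_apply]
  have hterm : ∀ R ∈ s, charFunDual (P.map fun ω => R (M (F ⁻¹' {R}) ω)) L =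
      Complex.exp (-(((volume (F ⁻¹' {R})).toReal * ‖L.comp R‖ ^ α : ℝ) : ℂ)) := by
    intro R hR
    have h1 : P.map (fun ω => R (M (F ⁻¹' {R}) ω)) = (P.map (M (F ⁻¹' {R}))).map R := by
      rw [Measure.map_map R.continuous.measurable (hmeas R hR)]; rfl
    rw [h1, MeasureTheory.charFunDual_map, hM.charFunDual_map hα hm (F.measurableSet_fiber R) (hfin R hR)]
  rw [Finset.prod_congr rfl hterm, ← Complex.exp_sum, Finset.sum_neg_distrib]
  congr 2
  rw [← Complex.ofReal_sum]
  congr 1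
  have hexp : stableExponent α F L = ∑ R ∈ F.range, ‖L.comp R‖ₑ ^ α * volume (F ⁻¹' {R}) := by
    rw [← SimpleFunc.map_lintegral (fun R : Op m => ‖L.comp R‖ₑ ^ α) F,
      ← SimpleFunc.lintegral_eq_lintegral]
    rfl
  have hexp2 : stableExponent α F L = ∑ R ∈ s, ‖L.comp R‖ₑ ^ α * volume (F ⁻¹' {R}) := by
    rw [hexp, hs, Finset.sum_filter_of_ne]
    rintro R _ h rfl
    apply h
    have h0 : ‖L.comp (0 : Op m)‖ₑ = 0 := by
      rw [← ofReal_norm, ContinuousLinearMap.comp_zero, norm_zero, ENNReal.ofReal_zero]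
    rw [h0, ENNReal.zero_rpow_of_pos hα, zero_mul]
  rw [hexp2, ENNReal.toReal_sum]
  · refine Finset.sum_congr rfl fun R hR => ?_
    rw [ENNReal.toReal_mul, ← ENNReal.toReal_rpow, toReal_enorm, mul_comm]
  · intro R hR
    exact (ENNReal.mul_lt_top (ENNReal.rpow_lt_top_of_nonneg hα.le enorm_ne_top) (hfin R hR)).ne


/-! ### Approximation by simple functions -/

section Approximation

variable {d m : ℕ} {α : ℝ}

theorem intNormPow_sub_comm (F G : Rn d → Op m) :
    intNormPow α (fun u => F u - G u) = intNormPow α (fun u => G u - F u) := by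
  refine lintegral_congr fun u => ?_
  rw [← ofReal_norm, norm_sub_rev, ofReal_norm]

theorem intNormPow_add_le (hα : 0 < α) {F G : Rn d → Op m} (hF : Measurable F) :
    intNormPow α (fun u => F u + G u) ≤ 2 ^ α * (intNormPow α F + intNormPow α G) := by
  rw [intNormPow, intNormPow, intNormPow, ← lintegral_add_left (hF.enorm.pow_const α),
    ← lintegral_const_mul' _ _ (ENNReal.rpow_lt_top_of_nonneg hα.le ENNReal.ofNat_ne_top).ne]
  exact lintegral_mono fun u => enorm_add_rpow_le hα _ _

theorem intNormPow_sub_le (hα : 0 < α) {F G H : Rn d → Op m} (hF : Measurable F)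
    (hH : Measurable H) :
    intNormPow α (fun u => F u - G u) ≤
      2 ^ α * (intNormPow α (fun u => F u - H u) + intNormPow α (fun u => G u - H u)) := by
  have h := intNormPow_add_le (α := α) hα (F := fun u => F u - H u) (G := fun u => H u - G u)
    (hF.sub hH)
  simp only [sub_add_sub_cancel] at h
  rwa [intNormPow_sub_comm H G] at h

theorem intNormPow_mul_le (hα : 0 < α) (R : Op m) (F : Rn d → Op m) :
    intNormPow α (fun u => R * F u) ≤ ‖R‖ₑ ^ α * intNormPow α F := by
  rw [intNormPow, intNormPow, ← lintegral_const_mul' _ _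
    (ENNReal.rpow_lt_top_of_nonneg hα.le enorm_ne_top).ne]
  refine lintegral_mono fun u => ?_
  rw [← ENNReal.mul_rpow_of_nonneg _ _ hα.le]
  exact ENNReal.rpow_le_rpow (R.opENorm_comp_le (F u)) hα.le

theorem enorm_rpow_eq_zero_iff {G : Type*} [NormedAddCommGroup G] (hα : 0 < α) {g : G} :
    ‖g‖ₑ ^ α = 0 ↔ g = 0 := by
  rw [ENNReal.rpow_eq_zero_iff_of_pos hα, enorm_eq_zero]

theorem finMeasSupp_of_intNormPow_lt_top (hα : 0 < α) {F : SimpleFunc (Rn d) (Op m)}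
    (hF : intNormPow α F < ∞) : F.FinMeasSupp volume := by
  have h : (F.map fun R => ‖R‖ₑ ^ α).FinMeasSupp volume := by
    refine SimpleFunc.FinMeasSupp.of_lintegral_ne_top ?_
    rw [← SimpleFunc.lintegral_eq_lintegral]
    exact hF.ne
  exact h.of_map fun R hR => (enorm_rpow_eq_zero_iff hα).1 hR

theorem exists_simpleFunc_tendsto (hα : 0 < α) {F : Rn d → Op m} (hF : Measurable F)
    (hF' : intNormPow α F < ∞) : ∃ Fn : ℕ → SimpleFunc (Rn d) (Op m),
      (∀ n, (Fn n).FinMeasSupp volume) ∧ (∀ n u, ‖Fn n u‖ₑ ≤ 2 * ‖F u‖ₑ) ∧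
      ∀ u, Tendsto (fun n => Fn n u) atTop (𝓝 (F u)) := by
  have hle : ∀ n u, ‖SimpleFunc.approxOn F hF Set.univ 0 (Set.mem_univ _) n u‖ₑ ≤ 2 * ‖F u‖ₑ := by
    intro n u
    have h := SimpleFunc.edist_approxOn_y0_le hF (Set.mem_univ (0 : Op m)) u n
    rwa [edist_zero_left, edist_zero_left, ← two_mul] at h
  refine ⟨SimpleFunc.approxOn F hF Set.univ 0 (Set.mem_univ _), fun n => ?_, hle, fun u =>
    SimpleFunc.tendsto_approxOn hF _ (by simp)⟩
  refine finMeasSupp_of_intNormPow_lt_top hα (lt_of_le_of_lt ?_ (ENNReal.mul_lt_top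
    (ENNReal.rpow_lt_top_of_nonneg hα.le (ENNReal.ofNat_ne_top (n := 2))) hF'))
  rw [intNormPow, intNormPow, ← lintegral_const_mul' _ _
    (ENNReal.rpow_lt_top_of_nonneg hα.le ENNReal.ofNat_ne_top).ne]
  refine lintegral_mono fun u => ?_
  rw [← ENNReal.mul_rpow_of_nonneg _ _ hα.le]
  exact ENNReal.rpow_le_rpow (hle n u) hα.le

theorem tendsto_enorm_rpow {G : Type*} [NormedAddCommGroup G] {f : ℕ → G} {g : G}
    (h : Tendsto f atTop (𝓝 g)) : Tendsto (fun n => ‖f n‖ₑ ^ α) atTop (𝓝 (‖g‖ₑ ^ α)) :=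
  (ENNReal.continuous_rpow_const.tendsto _).comp h.enorm

theorem approximates_of_tendsto (hα : 0 < α) {F : Rn d → Op m} (hF : Measurable F)
    (hF' : intNormPow α F < ∞) {Fn : ℕ → SimpleFunc (Rn d) (Op m)}
    (h : ∀ n, (Fn n).FinMeasSupp volume) (hle : ∀ n u, ‖Fn n u‖ₑ ≤ 2 * ‖F u‖ₑ)
    (hlim : ∀ u, Tendsto (fun n => Fn n u) atTop (𝓝 (F u))) : Approximates α Fn F := by
  refine ⟨h, ?_⟩
  have h3 : (3 : ℝ≥0∞) ^ α < ∞ := ENNReal.rpow_lt_top_of_nonneg hα.le ENNReal.ofNat_ne_top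
  have hdct := tendsto_lintegral_of_dominated_convergence (μ := (volume : Measure (Rn d)))
    (F := fun n u => ‖Fn n u - F u‖ₑ ^ α) (f := fun _ => 0) (fun u => 3 ^ α * ‖F u‖ₑ ^ α)
    (fun n => ((Fn n).measurable.sub hF).enorm.pow_const α) ?_ ?_ ?_
  · rwa [lintegral_zero] at hdct
  · refine fun n => Eventually.of_forall fun u => ?_
    beta_reduce
    rw [← ENNReal.mul_rpow_of_nonneg _ _ hα.le]
    refine ENNReal.rpow_le_rpow ?_ hα.le
    calc ‖Fn n u - F u‖ₑ ≤ ‖Fn n u‖ₑ + ‖F u‖ₑ := enorm_sub_le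
      _ ≤ 2 * ‖F u‖ₑ + ‖F u‖ₑ := by gcongr; exact hle n u
      _ = 3 * ‖F u‖ₑ := by rw [← add_one_mul]; norm_num
  · rw [lintegral_const_mul' _ _ h3.ne]
    exact (ENNReal.mul_lt_top h3 hF').ne
  · refine Eventually.of_forall fun u => ?_
    have h1 := tendsto_enorm_rpow (α := α) ((hlim u).sub_const (F u))
    rwa [(enorm_rpow_eq_zero_iff hα).2 (sub_self (F u))] at h1

theorem tendsto_stableExponent (hα : 0 < α) {F : Rn d → Op m}
    (hF' : intNormPow α F < ∞) {Fn : ℕ → SimpleFunc (Rn d) (Op m)}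
    (hle : ∀ n u, ‖Fn n u‖ₑ ≤ 2 * ‖F u‖ₑ)
    (hlim : ∀ u, Tendsto (fun n => Fn n u) atTop (𝓝 (F u))) (L : StrongDual ℝ (Rn m)) :
    Tendsto (fun n => stableExponent α (Fn n) L) atTop (𝓝 (stableExponent α F L)) := by
  have hc : (‖L‖ₑ * 2) ^ α < ∞ := ENNReal.rpow_lt_top_of_nonneg hα.le
    (ENNReal.mul_ne_top enorm_ne_top ENNReal.ofNat_ne_top)
  have hcont : Continuous fun R : Op m => L.comp R :=
    (ContinuousLinearMap.compL ℝ (Rn m) (Rn m) ℝ L).continuous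
  refine tendsto_lintegral_of_dominated_convergence (μ := (volume : Measure (Rn d)))
    (F := fun n u => ‖L.comp (Fn n u)‖ₑ ^ α) (fun u => (‖L‖ₑ * 2) ^ α * ‖F u‖ₑ ^ α)
    (fun n => (hcont.enorm.measurable.comp (Fn n).measurable).pow_const α) ?_ ?_ ?_
  · refine fun n => Eventually.of_forall fun u => ?_
    beta_reduce
    rw [← ENNReal.mul_rpow_of_nonneg _ _ hα.le]
    refine ENNReal.rpow_le_rpow ((L.opENorm_comp_le _).trans ?_) hα.le
    rw [mul_assoc]
    gcongr
    exact hle n u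
  · rw [lintegral_const_mul' _ _ hc.ne]
    exact (ENNReal.mul_lt_top hc hF').ne
  · exact Eventually.of_forall fun u => tendsto_enorm_rpow ((hcont.tendsto _).comp (hlim u))

end Approximation

/-! ### The stochastic integral -/

section StochasticIntegral

variable {Ω : Type*} [MeasurableSpace Ω] {P : Measure Ω} {α : ℝ} {d m : ℕ}
  {M : Set (Rn d) → Ω → Rn m} {F G : Rn d → Op m} {Y Z : Ω → Rn m}

theorem IsStochasticIntegral.ae_eq (hY : IsStochasticIntegral P α M F Y) (hZ : IsStochasticIntegral P α M F Z) :
    Y =ᵐ[P] Z := by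
  obtain ⟨Fn, hFn⟩ := hY.exists_approx
  exact tendstoInMeasure_ae_unique (hY.tendsto Fn hFn) (hZ.tendsto Fn hFn)

variable [IsProbabilityMeasure P]

theorem exists_measure_le_of_charFunDual (P : Measure Ω) [IsProbabilityMeasure P] (d m : ℕ)
    {ε : ℝ} (hα : 0 < α) (hε : 0 < ε) : ∃ K : ℝ≥0∞, K ≠ ∞ ∧
      ∀ (F : Rn d → Op m) (Z : Ω → Rn m), intNormPow α F < ∞ → Measurable Z →
        (∀ L, charFunDual (P.map Z) L = Complex.exp (-((stableExponent α F L).toReal : ℂ))) →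
        P {ω | ε ≤ ‖Z ω‖} ≤ K * intNormPow α F := by
  obtain ⟨K, hK0, hK⟩ := exists_measureReal_norm_le m hα hε
  refine ⟨ENNReal.ofReal K, ENNReal.ofReal_ne_top, fun F Z hF hZ h => ?_⟩
  have := Measure.isProbabilityMeasure_map (μ := P) hZ.aemeasurable
  have h1 := hK (P.map Z) (intNormPow α F).toReal ENNReal.toReal_nonneg fun L => by
    refine ⟨(stableExponent α F L).toReal, ENNReal.toReal_nonneg, ?_, h L⟩
    have h2 := ENNReal.toReal_mono (ENNReal.mul_lt_top
      (ENNReal.rpow_lt_top_of_nonneg hα.le enorm_ne_top) hF).ne (stableExponent_le hα F L)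
    rwa [ENNReal.toReal_mul, ← ENNReal.toReal_rpow, toReal_enorm] at h2
  rw [measureReal_def, Measure.map_apply hZ (measurableSet_le measurable_const measurable_norm)] at h1
  have h3 := ENNReal.ofReal_le_ofReal h1
  rwa [ENNReal.ofReal_toReal (measure_ne_top _ _), ENNReal.ofReal_mul hK0,
    ENNReal.ofReal_toReal hF.ne] at h3

theorem intNormPow_lt_top_of_finMeasSupp (hα : 0 < α) {F : SimpleFunc (Rn d) (Op m)}
    (h : F.FinMeasSupp volume) : intNormPow α F < ∞ := by
  have h1 : (F.map fun R => ‖R‖ₑ ^ α).FinMeasSupp volume :=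
    h.map ((enorm_rpow_eq_zero_iff hα).2 rfl)
  have h2 := h1.lintegral_lt_top (Eventually.of_forall fun u =>
    (ENNReal.rpow_lt_top_of_nonneg hα.le enorm_ne_top).ne)
  rwa [← SimpleFunc.lintegral_eq_lintegral] at h2

/-- Tail bound for differences of integrals of simple functions. -/
theorem IsSaSRandomMeasure.exists_measure_simpleIntegral_sub_le
    (hM : IsSaSRandomMeasure P α (control α d m) M) (hα : 0 < α) (hm : 1 ≤ m) {ε : ℝ}
    (hε : 0 < ε) : ∃ K : ℝ≥0∞, K ≠ ∞ ∧ ∀ F G : SimpleFunc (Rn d) (Op m),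
      F.FinMeasSupp volume → G.FinMeasSupp volume →
      P {ω | ε ≤ ‖simpleIntegral M F ω - simpleIntegral M G ω‖} ≤
        K * intNormPow α (fun u => F u - G u) := by
  obtain ⟨K, hK, h⟩ := exists_measure_le_of_charFunDual P d m hα hε
  refine ⟨K, hK, fun F G hF hG => ?_⟩
  have hFG : ((F.pair G).map fun p => p.1 - p.2).FinMeasSupp volume :=
    (hF.pair hG).map (sub_zero (0 : Op m))
  have h1 := h _ _ (intNormPow_lt_top_of_finMeasSupp hα hFG)
    (hM.measurable_simpleIntegral hFG) (hM.charFunDual_simpleIntegral hα hm hFG)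
  refine le_of_eq_of_le (measure_congr ?_) h1
  filter_upwards [hM.simpleIntegral_pair_sub hF hG] with ω hω
  change (ε ≤ ‖_‖) = (ε ≤ ‖_‖)
  rw [hω]

theorem isStochasticIntegral_of_tendsto (hM : IsSaSRandomMeasure P α (control α d m) M)
    (hα : 0 < α) (hm : 1 ≤ m) (hF : Measurable F) (hF' : intNormPow α F < ∞) (hY : Measurable Y)
    {Fn : ℕ → SimpleFunc (Rn d) (Op m)} (hFn : Approximates α Fn F)
    (hlim : TendstoInMeasure P (fun n => simpleIntegral M (Fn n)) atTop Y) :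
    IsStochasticIntegral P α M F Y := by
  refine ⟨hF, hF', hY, ⟨Fn, hFn⟩, fun Gn hGn => ?_⟩
  have hdiff : TendstoInMeasure P
      (fun n ω => simpleIntegral M (Gn n) ω - simpleIntegral M (Fn n) ω) atTop (fun _ => 0) := by
    rw [tendstoInMeasure_iff_norm]
    intro ε hε
    obtain ⟨K, hK, h⟩ := hM.exists_measure_simpleIntegral_sub_le hα hm hε
    have h0 : Tendsto (fun n => K * (2 ^ α * (intNormPow α (fun u => Gn n u - F u) +
        intNormPow α (fun u => Fn n u - F u)))) atTop (𝓝 0) := by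
      have h1 := ENNReal.Tendsto.const_mul (a := K) (ENNReal.Tendsto.const_mul (a := 2 ^ α)
        (hGn.2.add hFn.2) (Or.inr (ENNReal.rpow_lt_top_of_nonneg hα.le ENNReal.ofNat_ne_top).ne))
        (Or.inr hK)
      simpa using h1
    refine tendsto_of_tendsto_of_tendsto_of_le_of_le tendsto_const_nhds h0 (fun _ => zero_le)
      fun n => ?_
    simp only [sub_zero]
    refine (h _ _ (hGn.1 n) (hFn.1 n)).trans ?_
    gcongr
    exact intNormPow_sub_le hα (Gn n).measurable hF
  have h := tendstoInMeasure_add hdiff hlim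
  simpa using h

theorem exists_isStochasticIntegral (hM : IsSaSRandomMeasure P α (control α d m) M)
    (hα : 0 < α) (hm : 1 ≤ m) (hF : Measurable F) (hF' : intNormPow α F < ∞) :
    ∃ Y, IsStochasticIntegral P α M F Y := by
  obtain ⟨Fn, hfin, hle, hlim⟩ := exists_simpleFunc_tendsto hα hF hF'
  have hFn := approximates_of_tendsto hα hF hF' hfin hle hlim
  obtain ⟨Y, hY, hlimY⟩ := exists_tendstoInMeasure_of_cauchy (P := P)
    (f := fun n => simpleIntegral M (Fn n)) (fun n => hM.measurable_simpleIntegral (hfin n)) (by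
      intro ε hε δ hδ
      obtain ⟨K, hK, h⟩ := hM.exists_measure_simpleIntegral_sub_le hα hm hε
      have h2 : (2 : ℝ≥0∞) ^ α ≠ ∞ := (ENNReal.rpow_lt_top_of_nonneg hα.le ENNReal.ofNat_ne_top).ne
      have h0 : Tendsto (fun p : ℕ × ℕ => K * (2 ^ α * (intNormPow α (fun u => Fn p.1 u - F u) +
          intNormPow α (fun u => Fn p.2 u - F u)))) atTop (𝓝 0) := by
        have h1 := ENNReal.Tendsto.const_mul (a := K) (ENNReal.Tendsto.const_mul (a := 2 ^ α)
          ((hFn.2.comp tendsto_fst).add (hFn.2.comp tendsto_snd)) (Or.inr h2)) (Or.inr hK)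
        rw [prod_atTop_atTop_eq] at h1
        simpa using h1
      obtain ⟨N, hN⟩ := eventually_atTop.1 (h0.eventually_le_const hδ)
      refine ⟨max N.1 N.2, fun n hn k hk => ?_⟩
      refine ((h _ _ (hfin n) (hfin k)).trans ?_).trans
        (hN (n, k) ⟨(le_max_left _ _).trans hn, (le_max_right _ _).trans hk⟩)
      gcongr
      exact intNormPow_sub_le hα (Fn n).measurable hF)
  exact ⟨Y, isStochasticIntegral_of_tendsto hM hα hm hF hF' hY hFn hlimY⟩

theorem isStochasticIntegral_stochasticIntegral (hM : IsSaSRandomMeasure P α (control α d m) M)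
    (hα : 0 < α) (hm : 1 ≤ m) (hF : Measurable F) (hF' : intNormPow α F < ∞) :
    IsStochasticIntegral P α M F (stochasticIntegral P α M F) := by
  have h := exists_isStochasticIntegral hM hα hm hF hF'
  rw [stochasticIntegral, dif_pos h]
  exact h.choose_spec

namespace IsStochasticIntegral

theorem add (hM : IsSaSRandomMeasure P α (control α d m) M) (hα : 0 < α) (hm : 1 ≤ m)
    (hY : IsStochasticIntegral P α M F Y) (hZ : IsStochasticIntegral P α M G Z) :
    IsStochasticIntegral P α M (fun u => F u + G u) (fun ω => Y ω + Z ω) := by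
  obtain ⟨Fn, hFn⟩ := hY.exists_approx
  obtain ⟨Gn, hGn⟩ := hZ.exists_approx
  have h2 : (2 : ℝ≥0∞) ^ α < ∞ := ENNReal.rpow_lt_top_of_nonneg hα.le ENNReal.ofNat_ne_top
  refine isStochasticIntegral_of_tendsto (Fn := fun n => Fn n + Gn n) hM hα hm
    (hY.measurable_integrand.add hZ.measurable_integrand)
    ((intNormPow_add_le hα hY.measurable_integrand).trans_lt
      (ENNReal.mul_lt_top h2 (ENNReal.add_lt_top.2 ⟨hY.integrable, hZ.integrable⟩)))
    (hY.measurable.add hZ.measurable) ⟨fun n => (hFn.1 n).add (hGn.1 n), ?_⟩ ?_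
  · have h0 : Tendsto (fun n => 2 ^ α * (intNormPow α (fun u => Fn n u - F u) +
        intNormPow α (fun u => Gn n u - G u))) atTop (𝓝 0) := by
      have h1 := ENNReal.Tendsto.const_mul (a := 2 ^ α) (hFn.2.add hGn.2) (Or.inr h2.ne)
      simpa using h1
    refine tendsto_of_tendsto_of_tendsto_of_le_of_le tendsto_const_nhds h0 (fun _ => zero_le)
      fun n => ?_
    refine le_of_eq_of_le ?_ (intNormPow_add_le hα ((Fn n).measurable.sub hY.measurable_integrand))
    congr 1
    funext u
    exact add_sub_add_comm _ _ _ _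
  · refine (tendstoInMeasure_add (hY.tendsto Fn hFn) (hZ.tendsto Gn hGn)).congr_left fun n => ?_
    filter_upwards [hM.simpleIntegral_add (hFn.1 n) (hGn.1 n)] with ω hω using hω.symm

theorem mul_left (hM : IsSaSRandomMeasure P α (control α d m) M) (hα : 0 < α) (hm : 1 ≤ m)
    (hY : IsStochasticIntegral P α M F Y) (R : Op m) :
    IsStochasticIntegral P α M (fun u => R * F u) (fun ω => R (Y ω)) := by
  obtain ⟨Fn, hFn⟩ := hY.exists_approx
  have hR : ‖R‖ₑ ^ α < ∞ := ENNReal.rpow_lt_top_of_nonneg hα.le enorm_ne_top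
  refine isStochasticIntegral_of_tendsto (Fn := fun n => (Fn n).map (R * ·)) hM hα hm
    ((ContinuousLinearMap.compL ℝ (Rn m) (Rn m) (Rn m) R).continuous.measurable.comp
      hY.measurable_integrand)
    ((intNormPow_mul_le hα R F).trans_lt (ENNReal.mul_lt_top hR hY.integrable))
    (R.continuous.measurable.comp hY.measurable) ⟨fun n => (hFn.1 n).map (mul_zero R), ?_⟩ ?_
  · have h0 : Tendsto (fun n => ‖R‖ₑ ^ α * intNormPow α (fun u => Fn n u - F u)) atTop (𝓝 0) := by
      have h1 := ENNReal.Tendsto.const_mul (a := ‖R‖ₑ ^ α) hFn.2 (Or.inr hR.ne)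
      simpa using h1
    refine tendsto_of_tendsto_of_tendsto_of_le_of_le tendsto_const_nhds h0 (fun _ => zero_le)
      fun n => ?_
    refine le_of_eq_of_le ?_ (intNormPow_mul_le hα R _)
    congr 1
    funext u
    exact (mul_sub R _ _).symm
  · refine (tendstoInMeasure_of_lipschitz (φ := R) (K := ‖R‖) (fun x y => ?_)
      (hY.tendsto Fn hFn)).congr_left fun n => ?_
    · rw [← map_sub]; exact R.le_opNorm _
    · filter_upwards [hM.simpleIntegral_map_comp (hFn.1 n) R] with ω hω using hω.symm

theorem sub (hM : IsSaSRandomMeasure P α (control α d m) M) (hα : 0 < α) (hm : 1 ≤ m)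
    (hY : IsStochasticIntegral P α M F Y) (hZ : IsStochasticIntegral P α M G Z) :
    IsStochasticIntegral P α M (fun u => F u - G u) (fun ω => Y ω - Z ω) := by
  have h := hY.add hM hα hm (hZ.mul_left hM hα hm (-1))
  convert h using 2 with x x
  · have h1 : (-1 : Op m) * G x = -G x := neg_one_mul (G x)
    rw [h1]; exact sub_eq_add_neg _ _
  · rw [sub_eq_add_neg]; rfl

theorem zero (hM : IsSaSRandomMeasure P α (control α d m) M) (hα : 0 < α) (hm : 1 ≤ m) :
    IsStochasticIntegral P α M (fun _ => 0) (fun _ => 0) := by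
  obtain ⟨Y, hY⟩ := exists_isStochasticIntegral (P := P) hM hα hm
    (F := fun _ => 0) measurable_const (by
      have : intNormPow α (fun _ : Rn d => (0 : Op m)) = 0 := by
        rw [intNormPow, (enorm_rpow_eq_zero_iff hα).2 rfl, lintegral_zero]
      rw [this]; exact ENNReal.zero_lt_top)
  simpa using hY.mul_left hM hα hm 0

theorem sum {ι : Type*} (hM : IsSaSRandomMeasure P α (control α d m) M) (hα : 0 < α)
    (hm : 1 ≤ m) (s : Finset ι) {F : ι → Rn d → Op m} {Y : ι → Ω → Rn m}
    (h : ∀ i ∈ s, IsStochasticIntegral P α M (F i) (Y i)) :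
    IsStochasticIntegral P α M (fun u => ∑ i ∈ s, F i u) (fun ω => ∑ i ∈ s, Y i ω) := by
  classical
  induction s using Finset.induction_on with
  | empty => exact zero hM hα hm
  | insert a s ha ih =>
    simp only [Finset.sum_insert ha]
    exact (h a (Finset.mem_insert_self a s)).add hM hα hm
      (ih fun i hi => h i (Finset.mem_insert_of_mem hi))

theorem charFunDual_map (hM : IsSaSRandomMeasure P α (control α d m) M) (hα : 0 < α)
    (hm : 1 ≤ m) (hY : IsStochasticIntegral P α M F Y) (L : StrongDual ℝ (Rn m)) :
    charFunDual (P.map Y) L = Complex.exp (-((stableExponent α F L).toReal : ℂ)) := by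
  obtain ⟨Fn, hfin, hle, hlim⟩ := exists_simpleFunc_tendsto hα hY.measurable_integrand hY.integrable
  have hFn := approximates_of_tendsto hα hY.measurable_integrand hY.integrable hfin hle hlim
  obtain ⟨ns, hns, hae⟩ := (hY.tendsto Fn hFn).exists_seq_tendsto_ae
  have hcf : ∀ {Z : Ω → Rn m}, Measurable Z → charFunDual (P.map Z) L =
      ∫ ω, Complex.exp (L (Z ω) * Complex.I) ∂P := fun hZ => by
    rw [charFunDual_apply, integral_map hZ.aemeasurable]
    exact Continuous.aestronglyMeasurable (by fun_prop)
  have h1 : Tendsto (fun k => charFunDual (P.map (simpleIntegral M (Fn (ns k)))) L) atTop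
      (𝓝 (charFunDual (P.map Y) L)) := by
    rw [hcf hY.measurable]
    simp only [fun k => hcf (hM.measurable_simpleIntegral (hfin (ns k)))]
    refine tendsto_integral_of_dominated_convergence (fun _ => 1) (fun k => ?_)
      (integrable_const _) (fun k => Eventually.of_forall fun ω => ?_) ?_
    · have := hM.measurable_simpleIntegral (hfin (ns k))
      exact Measurable.aestronglyMeasurable (by fun_prop)
    · rw [Complex.norm_exp_ofReal_mul_I]
    · filter_upwards [hae] with ω hω
      have hc : Continuous fun x : Rn m => Complex.exp (L x * Complex.I) := by fun_prop
      exact (hc.tendsto _).comp hω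
  refine tendsto_nhds_unique h1 ?_
  simp only [fun k => hM.charFunDual_simpleIntegral hα hm (hfin (ns k)) L]
  have h2 : stableExponent α F L ≠ ∞ := ((stableExponent_le hα F L).trans_lt (ENNReal.mul_lt_top
    (ENNReal.rpow_lt_top_of_nonneg hα.le enorm_ne_top) hY.integrable)).ne
  have h3 := (ENNReal.tendsto_toReal h2).comp
    ((tendsto_stableExponent hα hY.integrable hle hlim L).comp hns.tendsto_atTop)
  have hc : Continuous fun x : ℝ => Complex.exp (-(x : ℂ)) := by fun_prop
  exact (hc.tendsto _).comp h3

end IsStochasticIntegral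

end StochasticIntegral

/-! ### Joint laws of stochastic integrals -/

/-- The exponent of the joint characteristic function of the integrals `∫ F t dM` at `L`. -/
def jointExponent {ι : Type*} {d m : ℕ} (α : ℝ) (F : ι → Rn d → Op m)
    (L : StrongDual ℝ (ι → Rn m)) : ℝ≥0∞ :=
  ∫⁻ u, ‖L.comp (ContinuousLinearMap.pi fun t => F t u)‖ₑ ^ α

theorem smulRight_sum_apply {ι G : Type*} [Fintype ι] [NormedAddCommGroup G] [NormedSpace ℝ G]
    {e : G} {L₀ : StrongDual ℝ G} (he : L₀ e = 1) (ℓ : ι → StrongDual ℝ G) (x : ι → G) :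
    L₀ (∑ t, (ℓ t).smulRight e (x t)) = ∑ t, ℓ t (x t) := by
  simp [map_sum, he]

section

variable {Ω : Type*} [MeasurableSpace Ω] {P : Measure Ω} [IsProbabilityMeasure P] {α : ℝ} {d m : ℕ}
  {M : Set (Rn d) → Ω → Rn m} {ι : Type*} [Fintype ι]

theorem IsStochasticIntegral.charFunDual_map_pi (hM : IsSaSRandomMeasure P α (control α d m) M)
    (hα : 0 < α) (hm : 1 ≤ m) {F : ι → Rn d → Op m} {Y : ι → Ω → Rn m}
    (h : ∀ t, IsStochasticIntegral P α M (F t) (Y t)) (L : StrongDual ℝ (ι → Rn m)) :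
    charFunDual (P.map fun ω t => Y t ω) L =
      Complex.exp (-((jointExponent α F L).toReal : ℂ)) := by
  classical
  let e : Rn m := EuclideanSpace.single ⟨0, hm⟩ 1
  let L₀ : StrongDual ℝ (Rn m) := innerSL ℝ e
  have he : L₀ e = 1 := by simp [L₀, e]
  let ℓ : ι → StrongDual ℝ (Rn m) := fun t =>
    L.comp (ContinuousLinearMap.single ℝ (fun _ => Rn m) t)
  have hsum := IsStochasticIntegral.sum hM hα hm Finset.univ
    (fun t _ => (h t).mul_left hM hα hm ((ℓ t).smulRight e))
  have h1 := hsum.charFunDual_map hM hα hm L₀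
  have hlin : ∀ x : ι → Rn m, L₀ (∑ t, (ℓ t).smulRight e (x t)) = L x := fun x => by
    rw [smulRight_sum_apply he]; exact ContinuousLinearMap.sum_comp_single _ _ L x
  have hYm : Measurable fun ω t => Y t ω := measurable_pi_lambda _ fun t => (h t).measurable
  have h2 : charFunDual (P.map fun ω t => Y t ω) L =
      charFunDual (P.map fun ω => ∑ t, (ℓ t).smulRight e (Y t ω)) L₀ := by
    rw [charFunDual_apply, charFunDual_apply, integral_map hYm.aemeasurable,
      integral_map hsum.measurable.aemeasurable]
    · simp only [hlin]
    · exact Continuous.aestronglyMeasurable (by fun_prop)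
    · exact Continuous.aestronglyMeasurable (by fun_prop)
  rw [h2, h1]
  congr 4
  refine lintegral_congr fun u => ?_
  congr 2
  ext v
  refine Eq.trans ?_ (hlin fun t => F t u v)
  change L₀ ((∑ t, (ℓ t).smulRight e * F t u) v) = _
  rw [sum_apply]
  rfl

theorem identDistrib_of_jointExponent_eq (hM : IsSaSRandomMeasure P α (control α d m) M)
    (hα : 0 < α) (hm : 1 ≤ m) {F G : ι → Rn d → Op m} {Y Z : ι → Ω → Rn m}
    (hY : ∀ t, IsStochasticIntegral P α M (F t) (Y t))
    (hZ : ∀ t, IsStochasticIntegral P α M (G t) (Z t))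
    (h : ∀ L, jointExponent α F L = jointExponent α G L) :
    IdentDistrib (fun ω t => Y t ω) (fun ω t => Z t ω) P P := by
  have hYm : Measurable fun ω t => Y t ω := measurable_pi_lambda _ fun t => (hY t).measurable
  have hZm : Measurable fun ω t => Z t ω := measurable_pi_lambda _ fun t => (hZ t).measurable
  refine ⟨hYm.aemeasurable, hZm.aemeasurable, ?_⟩
  have := Measure.isProbabilityMeasure_map (μ := P) hYm.aemeasurable
  have := Measure.isProbabilityMeasure_map (μ := P) hZm.aemeasurable
  refine Measure.ext_of_charFunDual (funext fun L => ?_)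
  rw [IsStochasticIntegral.charFunDual_map_pi hM hα hm hY,
    IsStochasticIntegral.charFunDual_map_pi hM hα hm hZ, h]

end

theorem jointExponent_smul {ι : Type*} [Fintype ι] {d m : ℕ} {α : ℝ} (hα : 0 < α)
    (F : ι → Rn d → Op m) (c : ℝ) (L : StrongDual ℝ (ι → Rn m)) :
    (jointExponent α F (c • L)).toReal = |c| ^ α * (jointExponent α F L).toReal := by
  have h : jointExponent α F (c • L) = ‖c‖ₑ ^ α * jointExponent α F L := by
    rw [jointExponent, jointExponent, ← lintegral_const_mul' _ _
      (ENNReal.rpow_lt_top_of_nonneg hα.le enorm_ne_top).ne]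
    refine lintegral_congr fun u => ?_
    rw [← ENNReal.mul_rpow_of_nonneg _ _ hα.le, ContinuousLinearMap.smul_comp, enorm_smul]
  rw [h, ENNReal.toReal_mul, ← ENNReal.toReal_rpow, toReal_enorm, Real.norm_eq_abs]

theorem isSaSLaw_of_charFunDual {G : Type*} [NormedAddCommGroup G] [NormedSpace ℝ G]
    [CompleteSpace G] [MeasurableSpace G] [BorelSpace G] [SecondCountableTopology G] {α : ℝ}
    (hα : 0 < α) (μ : Measure G) [IsProbabilityMeasure μ] {N : StrongDual ℝ G → ℝ}
    (hN : ∀ L, charFunDual μ L = Complex.exp (-(N L : ℂ)))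
    (hN' : ∀ (c : ℝ) L, N (c • L) = |c| ^ α * N L) : IsSaSLaw α μ := by
  have hsc : ∀ (c : ℝ) L, charFunDual (μ.map fun z => c • z) L =
      Complex.exp (-((|c| ^ α * N L : ℝ) : ℂ)) := fun c L => by
    have h := charFunDual_map (μ := μ) (c • ContinuousLinearMap.id ℝ G) L
    rw [ContinuousLinearMap.comp_smul, ContinuousLinearMap.comp_id, hN, hN'] at h
    exact h
  refine ⟨inferInstance, ?_, fun a b ha hb => ?_⟩
  · have : IsProbabilityMeasure (μ.map fun z => -z) :=
      Measure.isProbabilityMeasure_map measurable_neg.aemeasurable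
    refine Measure.ext_of_charFunDual (funext fun L => ?_)
    have h := hsc (-1) L
    simp only [neg_one_smul, abs_neg, abs_one, Real.one_rpow, one_mul] at h
    rw [h, hN]
  · let A : G × G →L[ℝ] G :=
      a • ContinuousLinearMap.fst ℝ G G + b • ContinuousLinearMap.snd ℝ G G
    have hA : (fun z : G × G => a • z.1 + b • z.2) = A := rfl
    have : IsProbabilityMeasure ((μ.prod μ).map A) :=
      Measure.isProbabilityMeasure_map A.continuous.measurable.aemeasurable
    have : IsProbabilityMeasure (μ.map fun z => (a ^ α + b ^ α) ^ α⁻¹ • z) :=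
      Measure.isProbabilityMeasure_map (measurable_const_smul _).aemeasurable
    rw [hA]
    refine Measure.ext_of_charFunDual (funext fun L => ?_)
    have h1 : (L.comp A).comp (ContinuousLinearMap.inl ℝ G G) = a • L := by
      ext z; simp [A]
    have h2 : (L.comp A).comp (ContinuousLinearMap.inr ℝ G G) = b • L := by
      ext z; simp [A]
    rw [charFunDual_map, charFunDual_prod, h1, h2, hsc, hN, hN, hN', hN', ← Complex.exp_add,
      abs_of_pos ha, abs_of_pos hb, abs_of_pos (by positivity), ← Real.rpow_mul (by positivity),
      inv_mul_cancel₀ hα.ne', Real.rpow_one]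
    congr 1
    push_cast
    ring

/-! ### The moving-average field -/

theorem enorm_comp_pi_smul_mul {ι W : Type*} [Fintype ι] [NormedAddCommGroup W] [NormedSpace ℝ W]
    (L : StrongDual ℝ (ι → W)) (c : ℝ) (A : W →L[ℝ] W) (B : ι → W →L[ℝ] W) :
    ‖L.comp (ContinuousLinearMap.pi fun t => (c • A) * B t)‖ₑ =
      ‖c‖ₑ * ‖L.comp (ContinuousLinearMap.pi fun t => A * B t)‖ₑ := by
  rw [← enorm_smul, ← ContinuousLinearMap.comp_smul]
  congr 2

section MovingAverage

variable {Ω : Type*} [MeasurableSpace Ω] {P : Measure Ω} [IsProbabilityMeasure P] {α : ℝ}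
  {d m : ℕ} [Nontrivial (Rn d)] {M : Set (Rn d) → Ω → Rn m} {E : Op d} {D : Op m} {β : ℝ}
  {τ φ : Rn d → ℝ}

theorem isStochasticIntegral_movingAverage (hM : IsSaSRandomMeasure P α (control α d m) M)
    (hα : 0 < α) (hm : 1 ≤ m) (h : KernelData E D β τ φ) (x : Rn d) :
    IsStochasticIntegral P α M (maKernel α E D φ x) (movingAverage P α M E D φ x) := by
  refine isStochasticIntegral_stochasticIntegral hM hα hm (measurable_maKernel h x) ?_
  rw [intNormPow_maKernel]
  exact h.translationCost_lt_top volume hα x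

theorem stochasticallyContinuous_movingAverage
    (hM : IsSaSRandomMeasure P α (control α d m) M) (hα : 0 < α) (hm : 1 ≤ m)
    (h : KernelData E D β τ φ) : StochasticallyContinuous P (movingAverage P α M E D φ) := by
  intro x₀
  rw [tendstoInMeasure_iff_norm]
  intro ε hε
  obtain ⟨K, hK, hle⟩ := exists_measure_le_of_charFunDual P d m hα hε
  have hX := isStochasticIntegral_movingAverage (P := P) hM hα hm h
  have h0 : Tendsto (fun x => K * translationCost volume α E D φ (x - x₀)) (𝓝 x₀) (𝓝 0) := by
    have h1 : Tendsto (fun x : Rn d => x - x₀) (𝓝 x₀) (𝓝 0) := by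
      have := (continuous_sub_right x₀).tendsto x₀
      rwa [sub_self] at this
    have h2 := ENNReal.Tendsto.const_mul (a := K)
      ((h.tendsto_translationCost volume hα).comp h1) (Or.inr hK)
    rwa [mul_zero] at h2
  refine tendsto_of_tendsto_of_tendsto_of_le_of_le tendsto_const_nhds h0 (fun _ => zero_le)
    fun x => ?_
  have hI := (hX x).sub hM hα hm (hX x₀)
  refine (hle _ _ hI.integrable hI.measurable (hI.charFunDual_map hM hα hm)).trans_eq ?_
  rw [intNormPow_maKernel_sub]

theorem jointExponent_maKernel_expFlow {ι : Type*} [Fintype ι] (hα : 0 < α)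
    (h : KernelData E D β τ φ) (x : ι → Rn d) (s : ℝ) (L : StrongDual ℝ (ι → Rn m)) :
    jointExponent α (fun t => maKernel α E D φ (expFlow E s (x t))) L =
      jointExponent α (fun t u => expFlow D s * maKernel α E D φ (x t) u) L := by
  rw [jointExponent, lintegral_expFlow volume E s, jointExponent,
    ← lintegral_const_mul' _ _ ENNReal.ofReal_ne_top]
  have hne : ∀ᵐ u : Rn d, u ≠ 0 ∧ ∀ t, x t ≠ u := by
    refine (Measure.ae_ne volume 0).and (ae_all_iff.2 fun t => ?_)
    filter_upwards [Measure.ae_ne volume (x t)] with u hu using hu.symm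
  refine lintegral_congr_ae ?_
  filter_upwards [hne] with u hu
  have h1 : (fun t => maKernel α E D φ (expFlow E s (x t)) (expFlow E s u)) = fun t =>
      (Real.exp (-(homDim E / α * s)) • expFlow D s) * maKernel α E D φ (x t) u := by
    funext t
    rw [maKernel_expFlow h s hu.1 (hu.2 t)]
    exact congrArg (· * maKernel α E D φ (x t) u) (expFlow_sub_smul_id D _ s)
  have h2 : ‖L.comp (ContinuousLinearMap.pi fun t =>
      maKernel α E D φ (expFlow E s (x t)) (expFlow E s u))‖ₑ =
      ‖Real.exp (-(homDim E / α * s))‖ₑ * ‖L.comp (ContinuousLinearMap.pi fun t =>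
        expFlow D s * maKernel α E D φ (x t) u)‖ₑ := by
    rw [h1]
    exact enorm_comp_pi_smul_mul L _ _ _
  rw [h2, ENNReal.mul_rpow_of_nonneg _ _ hα.le, ← mul_assoc]
  have h3 : ENNReal.ofReal (Real.exp (s * LinearMap.trace ℝ (Rn d) E)) *
      ‖Real.exp (-(homDim E / α * s))‖ₑ ^ α = 1 := by
    rw [← ofReal_norm, Real.norm_eq_abs, Real.abs_exp,
      ENNReal.ofReal_rpow_of_nonneg (Real.exp_pos _).le hα.le, ← Real.exp_mul,
      ← ENNReal.ofReal_mul (Real.exp_pos _).le, ← Real.exp_add, ← ENNReal.ofReal_one,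
      ← Real.exp_zero]
    congr 2
    have : homDim E = LinearMap.trace ℝ (Rn d) E := rfl
    rw [← this]
    field_simp
    ring
  rw [h3, one_mul]

theorem isOSS_movingAverage (hM : IsSaSRandomMeasure P α (control α d m) M) (hα : 0 < α)
    (hm : 1 ≤ m) (h : KernelData E D β τ φ) : IsOSS P E D (movingAverage P α M E D φ) := by
  intro r _ T
  have hX := isStochasticIntegral_movingAverage (P := P) hM hα hm h
  exact identDistrib_of_jointExponent_eq hM hα hm (fun t : T => hX (opPow r E t))
    (fun t : T => (hX t).mul_left hM hα hm (opPow r D))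
    (jointExponent_maKernel_expFlow hα h (fun t : T => (t : Rn d)) (Real.log r))

theorem isSaSField_movingAverage (hM : IsSaSRandomMeasure P α (control α d m) M) (hα : 0 < α)
    (hm : 1 ≤ m) (h : KernelData E D β τ φ) : IsSaSField P α (movingAverage P α M E D φ) := by
  have hX := isStochasticIntegral_movingAverage (P := P) hM hα hm h
  refine ⟨fun x => (hX x).measurable.aemeasurable, fun T => ?_⟩
  have hmeas : Measurable fun ω (t : T) => movingAverage P α M E D φ t ω :=
    measurable_pi_lambda _ fun t => (hX t).measurable
  have := Measure.isProbabilityMeasure_map (μ := P) hmeas.aemeasurable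
  exact isSaSLaw_of_charFunDual hα _
    (IsStochasticIntegral.charFunDual_map_pi hM hα hm (fun t : T => hX t))
    (jointExponent_smul hα _)

theorem hasStationaryIncrements_movingAverage (hM : IsSaSRandomMeasure P α (control α d m) M)
    (hα : 0 < α) (hm : 1 ≤ m) (h : KernelData E D β τ φ) :
    HasStationaryIncrements P (movingAverage P α M E D φ) := by
  intro z T
  have hX := isStochasticIntegral_movingAverage (P := P) hM hα hm h
  refine identDistrib_of_jointExponent_eq hM hα hm
    (fun t : T => (hX (t + z)).sub hM hα hm (hX z)) (fun t : T => hX t) fun L => ?_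
  simp only [jointExponent, maKernel_sub, add_sub_cancel_right]
  exact lintegral_sub_right_eq_self (fun u => ‖L.comp (ContinuousLinearMap.pi fun t : T =>
    maKernel α E D φ t u)‖ₑ ^ α) z

end MovingAverage

end OSS

end

theorem mainTheorem4 {Ω : Type*} [MeasurableSpace Ω] (P : MeasureTheory.Measure Ω)
    [MeasureTheory.IsProbabilityMeasure P] (d m : ℕ) (hd : 2 ≤ d) (hm : 2 ≤ m)
    (α : ℝ) (hα : 0 < α) (hα2 : α ≤ 2)
    (M : Set (OSS.Rn d) → Ω → OSS.Rn m)
    (hM : OSS.IsSaSRandomMeasure P α (OSS.control α d m) M)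
    (E : OSS.Op d) (hE : E ∈ OSS.Q d) (D : OSS.Op m) (hD : D ∈ OSS.Q m)
    (β : ℝ) (hβ : 0 < β) (φ : OSS.Rn d → ℝ)
    (hφ_hom : OSS.IsHomogeneous E φ) (hφ_adm : OSS.IsAdmissible β E φ)
    (H : ℝ) (hH : IsGreatest (OSS.reEigenvalues D) H) (hHβ : H < β) :
    (∀ x : OSS.Rn d,
      OSS.IsStochasticIntegral P α M (OSS.maKernel α E D φ x)
        (OSS.movingAverage P α M E D φ x) ∧
      ∀ Y : Ω → OSS.Rn m, OSS.IsStochasticIntegral P α M (OSS.maKernel α E D φ x) Y →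
        Y =ᵐ[P] OSS.movingAverage P α M E D φ x) ∧
    OSS.StochasticallyContinuous P (OSS.movingAverage P α M E D φ) ∧
    OSS.IsOSS P E D (OSS.movingAverage P α M E D φ) ∧
    OSS.IsSaSField P α (OSS.movingAverage P α M E D φ) ∧
    OSS.HasStationaryIncrements P (OSS.movingAverage P α M E D φ) := by
  have : Nonempty (Fin d) := ⟨⟨0, by omega⟩⟩
  have hK := OSS.kernelData_of_isAdmissible (by omega) (by omega) hE hD hβ hφ_hom hφ_adm hH hHβ
  have hm1 : 1 ≤ m := by omega
  have hX := OSS.isStochasticIntegral_movingAverage (P := P) hM hα hm1 hK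
  exact ⟨fun x => ⟨hX x, fun Y hY => hY.ae_eq (hX x)⟩,
    OSS.stochasticallyContinuous_movingAverage hM hα hm1 hK,
    OSS.isOSS_movingAverage hM hα hm1 hK, OSS.isSaSField_movingAverage hM hα hm1 hK,
    OSS.hasStationaryIncrements_movingAverage hM hα hm1 hK⟩
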